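/- **Model.** Let $N\ge 1$ and let $\phi=(\phi_{ijk})_{1\le i,j,k\le N}$ be a complex tensor of rank three, with $\hat\phi_{kji}=\overline{\phi_{ijk}}$. The i.i.d. multi-orientable (m.o.) model has action $$S[\phi]=\frac12\sum_{i,j,k}\hat\phi_{kji}\phi_{ijk}+\frac{\lambda}{4k_N}\sum_{i,j,k,i',j',k'}\phi_{ijk}\,\hat\phi_{kj'i'}\,\phi_{i'jk'}\,\hat\phi_{k'j'i},\qquad k_N=N^{3/2}.$$ Its partition function is the formal power series in $\lambda$ obtained by expanding $Z(\lambda,N)=\int e^{-S[\phi]}d\phi\big/\int e^{-S_0[\phi]}d\phi$ in powers of $\lambda$, where $S_0$ is the quadratic part of $S$, and its free energy is the formal power series $F(\lambda,N)=-\ln Z(\lambda,N)$. **Graphs.** A vacuum m.o. graph has finitely many vertices, each with four half-edges $\phi_1,\hat\phi_2,\phi_3,\hat\phi_4$ in cyclic order, and every edge joins a $\phi$ to a $\hat\phi$. Every half-edge carries three strands, of types $a$ (third index of $\phi$), $b$ (first index) and $c$ (second index). At a vertex, strands of type $a$ join $\phi_1$ to $\hat\phi_2$ and $\phi_3$ to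 $\hat\phi_4$, strands of type $b$ join $\hat\phi_2$ to $\phi_3$ and $\hat\phi_4$ to $\phi_1$, and strands of type $c$ join $\phi_1$ to $\phi_3$ and $\hat\phi_2$ to $\hat\phi_4$; along the edges each strand continues with the same type. Connected graphs are required to have at least one vertex. Graphs are considered up to isomorphism: an isomorphism may rotate a vertex by $\phi_1\leftrightarrow\phi_3$, $\hat\phi_2\leftrightarrow\hat\phi_4$. The three jackets of $\mathcal G$ are the ribbon graphs obtained by deleting all strands of one of the three types. The non-orientable genus $k_{\mathcal J}$ of a connected ribbon graph is given by $v-e+f=2-k_{\mathcal J}$, and the degree of $\mathcal G$ is $\varpi(\mathcal G)=\frac12\sum_{\mathcal J}k_{\mathcal J}$, the sum over its three jackets. The amplitude $A(\mathcal G)$ is $(\lambda/k_N)^{v(\mathcal G)}$, $v(\mathcal G)$ being the number of vertices, times the sum over all indices in $\{1,\dots,N\}$ carried by the strands of the product of the Kronecker deltas of the vertices and edges. Let $s(\mathcal G)=|\mathrm{Aut}(\mathcal G)|/2^{v(\mathcal G)}$. The elementary melon is the graph with two vertices $x,y$ in which, for $m\in\{1,3\}$, the half-edge $\phi_m$ of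 $x$ is joined to $\hat\phi_{m+1}$ of $y$ and $\phi_m$ of $y$ to $\hat\phi_{m+1}$ of $x$. A graph is melonic if it is obtained from the elementary melon by finitely many (possibly zero) successive insertions, each of which cuts an edge of the graph and inserts there an elementary melon with one of its edges cut (each open $\phi$ being joined to an open $\hat\phi$ of the other piece). **Theorem.** 1. For every connected vacuum m.o. graph $\mathcal G$, the three jackets are connected, $k_{\mathcal J}\ge 0$ for each of them, $\varpi(\mathcal G)\in\frac12\mathbb N=\{0,\frac12,1,\dots\}$, and for all $\lambda\in\mathbb C$ and $N\ge1$ $$A(\mathcal G)=\lambda^{v(\mathcal G)}N^{3-\varpi(\mathcal G)}.$$ 2. As a formal power series in $\lambda$, the free energy is $$F(\lambda,N)=\sum_{\mathcal G}\frac{(-1)^{v(\mathcal G)+1}}{s(\mathcal G)}A(\mathcal G)=\sum_{\varpi\in\frac12\mathbb N}C^{[\varpi]}(\lambda)\,N^{3-\varpi},\qquad C^{[\varpi]}(\lambda)=\sum_{\mathcal G:\ \varpi(\mathcal G)=\varpi}\frac{(-1)^{v(\mathcal G)+1}}{s(\mathcal G)}\lambda^{v(\mathcal G)},$$ where the sums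 run over the isomorphism classes of connected vacuum m.o. graphs; in each order in $\lambda$ only finitely many $C^{[\varpi]}$ are non-zero. 3. A vacuum m.o. graph is connected and of degree $\varpi=0$, that is, contributes to the leading term of the expansion, if and only if it is melonic. -/

import Mathlib

universe u v w

noncomputable section

namespace MultiOrientable

/-! ### Ribbon graphs -/

/-- The number of orbits on `X` of the group generated by two permutations. -/
def orbitCount {X : Type u} (α β : Equiv.Perm X) : ℕ :=
  Nat.card (MulAction.orbitRel.Quotient (Subgroup.closure ({α, β} : Set (Equiv.Perm X))) X)

/-- A (possibly non-orientable) ribbon graph, encoded by its flags. A flag is one of the two sides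
of a half-edge. The involution `side` exchanges the two sides of a half-edge, `edge` follows a
border of the ribbon to the other end of the edge, and `corner` follows the boundary of the vertex
disc to the neighbouring half-edge. -/
structure RibbonGraph where
  /-- the sides of half-edges -/
  Flag : Type u
  /-- exchange the two sides of a half-edge -/
  side : Equiv.Perm Flag
  /-- follow the boundary of a vertex between two consecutive half-edges -/
  corner : Equiv.Perm Flag
  /-- follow a border of an edge -/
  edge : Equiv.Perm Flag
  side_side : ∀ x, side (side x) = x
  corner_corner : ∀ x, corner (corner x) = x
  edge_edge : ∀ x, edge (edge x) = x
  side_ne : ∀ x, side x ≠ x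
  corner_ne : ∀ x, corner x ≠ x
  edge_ne : ∀ x, edge x ≠ x
  side_edge : ∀ x, side (edge x) = edge (side x)
  side_edge_ne : ∀ x, side (edge x) ≠ x

namespace RibbonGraph

variable (R : RibbonGraph.{u})

/-- The number of vertices (discs). -/
def numVertices : ℕ := orbitCount R.side R.corner

/-- The number of edges (ribbons). -/
def numEdges : ℕ := orbitCount R.side R.edge

/-- The number of faces (boundary components). -/
def numFaces : ℕ := orbitCount R.corner R.edge

/-- A ribbon graph is connected if it is non-empty and any two of its flags are joined by a
sequence of the three basic moves. -/
def Connected : Prop :=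
  Nonempty R.Flag ∧
    MulAction.IsPretransitive
      (Subgroup.closure ({R.side, R.corner, R.edge} : Set (Equiv.Perm R.Flag))) R.Flag

/-- The Euler characteristic `v - e + f` of the closed surface obtained by gluing a disc to each
face. -/
def eulerChar : ℤ := R.numVertices - R.numEdges + R.numFaces

/-- The non-orientable genus `k` of a connected ribbon graph: `χ = 2 - k`, so that `k = 2 g` for an
orientable surface of genus `g`. -/
def nonorientableGenus : ℤ := 2 - R.eulerChar

end RibbonGraph

/-! ### Multi-orientable graphs -/

/-- The three types of strands: `a` carries the indices in `E₃`, `b` those in `E₁`, and the inner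
strands `c` those in `E₂`. -/
inductive StrandType : Type
  | a
  | b
  | c
  deriving DecidableEq

instance : Fintype StrandType where
  elems := {StrandType.a, StrandType.b, StrandType.c}
  complete := by intro t; cases t <;> simp

/-- A vacuum multi-orientable Feynman graph with vertex set `V`. Every vertex `x` has two
half-edges `φ`, labelled by `(x, false)` and `(x, true)`, and two half-edges `φ̂`, labelled likewise,
in the cyclic order `φ (x, false)`, `φ̂ (x, false)`, `φ (x, true)`, `φ̂ (x, true)`. Each edge joins
a half-edge `φ` to a half-edge `φ̂`. -/
@[ext]
structure MOGraph (V : Type u) where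
  /-- the half-edge `φ̂` to which a given half-edge `φ` is joined -/
  edge : V × Bool ≃ V × Bool

/-- The half-edges: `Sum.inl` for the half-edges `φ`, and `Sum.inr` for the half-edges `φ̂`. -/
abbrev HalfEdge (V : Type u) : Type u := (V × Bool) ⊕ (V × Bool)

/-- Each half-edge consists of three strands, one of each type. -/
abbrev StrandEnd (V : Type u) : Type u := HalfEdge V × StrandType

/-- The half-edge at the same vertex to which the strand of a given type leads. The corner strands
join consecutive half-edges and opposite corners have the same type; the inner strands join
opposite half-edges. -/
def vertexHalfEdge {V : Type u} : StrandType → HalfEdge V → HalfEdge V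
  | .a, .inl (x, i) => .inr (x, i)
  | .a, .inr (x, i) => .inl (x, i)
  | .b, .inl (x, i) => .inr (x, !i)
  | .b, .inr (x, i) => .inl (x, !i)
  | .c, .inl (x, i) => .inl (x, !i)
  | .c, .inr (x, i) => .inr (x, !i)

theorem vertexHalfEdge_vertexHalfEdge {V : Type u} (t : StrandType) (h : HalfEdge V) :
    vertexHalfEdge t (vertexHalfEdge t h) = h := by
  rcases t <;> rcases h with ⟨x, i⟩ | ⟨x, i⟩ <;> simp [vertexHalfEdge]

theorem vertexHalfEdge_ne {V : Type u} (t : StrandType) (h : HalfEdge V) :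
    vertexHalfEdge t h ≠ h := by
  rcases t <;> rcases h with ⟨x, i⟩ | ⟨x, i⟩ <;> simp [vertexHalfEdge]

/-- The third strand type, when `s ≠ t`. -/
def StrandType.third : StrandType → StrandType → StrandType
  | .a, .b => .c
  | .b, .a => .c
  | .a, .c => .b
  | .c, .a => .b
  | .b, .c => .a
  | .c, .b => .a
  | s, _ => s

theorem StrandType.third_ne_left {t s : StrandType} (h : s ≠ t) : t.third s ≠ t := by
  cases t <;> cases s <;> simp_all [StrandType.third]

theorem StrandType.third_ne_right {t s : StrandType} (h : s ≠ t) : t.third s ≠ s := by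
  cases t <;> cases s <;> simp_all [StrandType.third]

theorem StrandType.third_third {t s : StrandType} (h : s ≠ t) : t.third (t.third s) = s := by
  cases t <;> cases s <;> simp_all [StrandType.third]

namespace MOGraph

section Basic

variable {V : Type u} (G : MOGraph V)

/-- The other end of the edge containing a given half-edge. -/
def partner : HalfEdge V → HalfEdge V
  | .inl p => .inr (G.edge p)
  | .inr q => .inl (G.edge.symm q)

theorem partner_partner (h : HalfEdge V) : G.partner (G.partner h) = h := by
  rcases h with p | q <;> simp [partner]

theorem partner_ne (h : HalfEdge V) : G.partner h ≠ h := by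
  rcases h with p | q <;> simp [partner]

/-- A multi-orientable graph is connected if its underlying graph is (in particular, it has a
vertex). -/
def Connected : Prop :=
  (SimpleGraph.fromRel fun x y : V => ∃ i j, G.edge (x, i) = (y, j)).Connected

/-- The jacket that excludes the strands of type `t`. Its half-edges have as their two sides the
strands of the two other types. -/
def jacket (t : StrandType) : RibbonGraph.{u} where
  Flag := HalfEdge V × {s : StrandType // s ≠ t}
  side := Function.Involutive.toPerm
    (fun x => (x.1, ⟨t.third x.2.1, StrandType.third_ne_left x.2.2⟩))
    (fun x => Prod.ext rfl (Subtype.ext (StrandType.third_third x.2.2)))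
  corner := Function.Involutive.toPerm (fun x => (vertexHalfEdge x.2.1 x.1, x.2))
    (fun _ => Prod.ext (vertexHalfEdge_vertexHalfEdge _ _) rfl)
  edge := Function.Involutive.toPerm (fun x => (G.partner x.1, x.2))
    (fun _ => Prod.ext (G.partner_partner _) rfl)
  side_side x := Prod.ext rfl (Subtype.ext (StrandType.third_third x.2.2))
  corner_corner _ := Prod.ext (vertexHalfEdge_vertexHalfEdge _ _) rfl
  edge_edge _ := Prod.ext (G.partner_partner _) rfl
  side_ne x h := StrandType.third_ne_right x.2.2 (congrArg (fun y => y.2.1) h)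
  corner_ne _ h := vertexHalfEdge_ne _ _ (congrArg Prod.fst h)
  edge_ne _ h := G.partner_ne _ (congrArg Prod.fst h)
  side_edge _ := rfl
  side_edge_ne _ h := G.partner_ne _ (congrArg Prod.fst h)

/-- The degree `ϖ`: half the sum of the non-orientable genera of the three jackets. -/
def degree : ℚ := ∑ t : StrandType, ((G.jacket t).nonorientableGenus : ℚ) / 2

end Basic

/-! ### Isomorphisms and symmetry factors -/

/-- An isomorphism of multi-orientable graphs: a bijection between the vertices, together with
the choice, at each vertex, of one of the two rotations that preserve the vertex and its strands
(the identity, or the rotation exchanging the two `φ` and exchanging the two `φ̂`), compatible with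
the edges. -/
structure Iso {V : Type u} {W : Type v} (G : MOGraph V) (H : MOGraph W) where
  /-- the bijection between the vertices -/
  vertex : V ≃ W
  /-- whether the half-edges at a vertex are rotated -/
  flip : V → Bool
  edge_comm : ∀ p : V × Bool,
    H.edge (vertex p.1, xor p.2 (flip p.1)) =
      (vertex (G.edge p).1, xor (G.edge p).2 (flip (G.edge p).1))

/-- The identity isomorphism. -/
def Iso.refl {V : Type u} (G : MOGraph V) : Iso G G where
  vertex := Equiv.refl V
  flip _ := false
  edge_comm p := by simp

/-- The inverse isomorphism. -/
def Iso.symm {V : Type u} {W : Type v} {G : MOGraph V} {H : MOGraph W} (f : Iso G H) :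
    Iso H G where
  vertex := f.vertex.symm
  flip y := f.flip (f.vertex.symm y)
  edge_comm := by
    rintro ⟨y, i⟩
    have h := f.edge_comm (f.vertex.symm y, xor i (f.flip (f.vertex.symm y)))
    simp only [Equiv.apply_symm_apply, Bool.xor_assoc, Bool.xor_self, Bool.xor_false] at h
    simp [h]

/-- The composition of two isomorphisms. -/
def Iso.trans {V : Type u} {W : Type v} {X : Type w} {G : MOGraph V} {H : MOGraph W}
    {K : MOGraph X} (f : Iso G H) (g : Iso H K) : Iso G K where
  vertex := f.vertex.trans g.vertex
  flip x := xor (f.flip x) (g.flip (f.vertex x))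
  edge_comm := by
    rintro ⟨x, i⟩
    have h := g.edge_comm (f.vertex x, xor i (f.flip x))
    have h' := f.edge_comm (x, i)
    simp only at h h'
    simp only [h', Bool.xor_assoc] at h
    simp [h]

/-- The symmetry factor `s(G)`: with the normalization of the action used here (a factor `1 / 4`
at each vertex and propagator `2`) it is the number of automorphisms divided by `2 ^ v`. -/
def symmetryFactor {V : Type u} [Fintype V] (G : MOGraph V) : ℚ :=
  (Nat.card (Iso G G) : ℚ) / 2 ^ Fintype.card V

/-! ### Melonic graphs -/

/-- The elementary vacuum melon, with two vertices and four edges. -/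
def elementaryMelon : MOGraph Bool where
  edge :=
    { toFun := fun p => (!p.1, p.2)
      invFun := fun p => (!p.1, p.2)
      left_inv := fun p => by simp
      right_inv := fun p => by simp }

/-- The disjoint union of two multi-orientable graphs. -/
def disjointUnion {V : Type u} {W : Type v} (G : MOGraph V) (H : MOGraph W) :
    MOGraph (V ⊕ W) where
  edge := (Equiv.sumProdDistrib V W Bool).trans
    ((Equiv.sumCongr G.edge H.edge).trans (Equiv.sumProdDistrib V W Bool).symm)

open Classical in
/-- The insertion of the elementary melonic two-point function (the elementary melon with one edge
cut) on the edge of `G` that starts at the half-edge `p`: both edges are cut, and the four open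
half-edges are joined crosswise, each `φ` to a `φ̂`. -/
def insertMelon {V : Type u} (G : MOGraph V) (p : V × Bool) : MOGraph (V ⊕ Bool) where
  edge := (Equiv.swap ((Sum.inl p.1 : V ⊕ Bool), p.2) (Sum.inr false, false)).trans
    (G.disjointUnion elementaryMelon).edge

/-- Melonic graphs: the graphs obtained, up to isomorphism, from the elementary vacuum melon by
recursive insertions of the elementary melonic two-point function on any edge. -/
inductive IsMelonic : {V : Type u} → MOGraph V → Prop
  | elementary {V : Type u} (G : MOGraph V) : Nonempty (Iso elementaryMelon G) → IsMelonic G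
  | insertion {V W : Type u} (G : MOGraph V) (p : V × Bool) (H : MOGraph W) :
      IsMelonic G → Nonempty (Iso (G.insertMelon p) H) → IsMelonic H

end MOGraph

/-! ### Amplitudes -/

/-- The indices `(i, j, k)` of a tensor of size `N`. -/
abbrev Index (N : ℕ) : Type := Fin N × Fin N × Fin N

/-- The scaling constant `k_N = N ^ (3 / 2)`. -/
def scaling (N : ℕ) : ℝ := (N : ℝ) ^ (3 / 2 : ℝ)

/-- The vertex: the product of the Kronecker deltas of `φ_{ijk} φ̂_{kj'i'} φ_{i'jk'} φ̂_{k'j'i}`,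
where `p`, `q`, `r`, `s` are the indices of the four fields in this order. -/
def vertexTensor {N : ℕ} (p q r s : Index N) : ℂ :=
  if p.2.2 = q.1 ∧ q.2.2 = r.1 ∧ r.2.2 = s.1 ∧ s.2.2 = p.1 ∧ p.2.1 = r.2.1 ∧ q.2.1 = s.2.1
  then 1 else 0

/-- The product of the Kronecker deltas of the propagator between `φ_{ijk}` and `φ̂_{k'j'i'}`. -/
def propagator {N : ℕ} (p q : Index N) : ℂ :=
  if p.1 = q.2.2 ∧ p.2.1 = q.2.1 ∧ p.2.2 = q.1 then 1 else 0

open Classical in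
/-- The amplitude of a graph, by the Feynman rules: every vertex has a factor `lam / k_N`, and the
Kronecker deltas of the vertices and of the propagators are summed over all indices `p` of the
half-edges `φ` and `q` of the half-edges `φ̂`. -/
def amplitude {V : Type u} [Fintype V] (G : MOGraph V) (lam : ℂ) (N : ℕ) : ℂ :=
  (lam / (scaling N : ℂ)) ^ Fintype.card V *
    ∑ p : V × Bool → Index N, ∑ q : V × Bool → Index N,
      (∏ x : V, vertexTensor (p (x, false)) (q (x, false)) (p (x, true)) (q (x, true))) *
        ∏ h : V × Bool, propagator (p h) (q (G.edge h))

/-! ### The free energy -/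

/-- The conjugate field `φ̂_{kji}`, the complex conjugate of `φ_{ijk}`. -/
def hatField {N : ℕ} (φ : Index N → ℂ) : Index N → ℂ :=
  fun p => (starRingEnd ℂ) (φ (p.2.2, p.2.1, p.1))

/-- The quadratic part of the action. -/
def freeAction {N : ℕ} (φ : Index N → ℂ) : ℂ :=
  (1 / 2) * ∑ i, ∑ j, ∑ k, hatField φ (k, j, i) * φ (i, j, k)

/-- The interaction divided by the coupling constant, and rescaled by `k_N`. -/
def interaction {N : ℕ} (φ : Index N → ℂ) : ℂ :=
  1 / (4 * (scaling N : ℂ)) * ∑ i, ∑ j, ∑ k, ∑ i', ∑ j', ∑ k',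
    φ (i, j, k) * hatField φ (k, j', i') * φ (i', j, k') * hatField φ (k', j', i)

/-- The expectation for the normalized Gaussian measure with density proportional to
`exp (- freeAction φ)`. -/
def gaussianMean {N : ℕ} (P : (Index N → ℂ) → ℂ) : ℂ :=
  (∫ φ : Index N → ℂ, Complex.exp (-freeAction φ) * P φ) /
    ∫ φ : Index N → ℂ, Complex.exp (-freeAction φ)

/-- The partition function, as a formal power series in the coupling constant: the perturbative
expansion of the normalized integral of `exp (-S)`. -/
def partitionFunction (N : ℕ) : PowerSeries ℂ :=
  PowerSeries.mk fun n =>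
    gaussianMean (N := N) (fun φ => (-interaction φ) ^ n) / (n.factorial : ℂ)

/-- The free energy `F = - log Z`, a formal power series in the coupling constant. -/
def freeEnergy (N : ℕ) : PowerSeries ℂ :=
  -(PowerSeries.log ℂ).subst (partitionFunction N - 1)

/-! ### The sum over Feynman graphs -/

/-- Isomorphism of multi-orientable graphs on the vertices `0, …, n - 1`. -/
instance isoSetoid (n : ℕ) : Setoid (MOGraph (Fin n)) where
  r G H := Nonempty (MOGraph.Iso G H)
  iseqv :=
    { refl := fun G => ⟨MOGraph.Iso.refl G⟩
      symm := fun ⟨f⟩ => ⟨f.symm⟩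
      trans := fun ⟨f⟩ ⟨g⟩ => ⟨f.trans g⟩ }

/-- The isomorphism classes of vacuum multi-orientable graphs with `n` vertices. -/
abbrev FeynmanGraph (n : ℕ) : Type := Quotient (isoSetoid n)

instance (n : ℕ) : Finite (MOGraph (Fin n)) :=
  Finite.of_injective MOGraph.edge fun _ _ h => MOGraph.ext h

instance (n : ℕ) : Fintype (FeynmanGraph n) := Fintype.ofFinite _

open Classical in
/-- The sum of `A G / s(G)` over the isomorphism classes of connected vacuum multi-orientable graphs
with `n` vertices that satisfy `P`, computed with representatives. -/
def graphSum (n : ℕ) (P : MOGraph (Fin n) → Prop) (A : MOGraph (Fin n) → ℂ) : ℂ :=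
  ∑ q : FeynmanGraph n,
    if q.out.Connected ∧ P q.out then A q.out / (q.out.symmetryFactor : ℂ) else 0

/-- The coefficient of `N ^ (3 - m / 2)` in the free energy, a formal power series in the coupling
constant: the sum of `(-1) ^ (v + 1) lam ^ v / s(G)` over the connected graphs `G` of degree
`m / 2`. -/
def freeEnergyCoeff (m : ℕ) : PowerSeries ℂ :=
  PowerSeries.mk fun n => (-1) ^ (n + 1) * graphSum n (fun G => G.degree = (m : ℚ) / 2) fun _ => 1

end MultiOrientable

end

/-! ### Orbits of two permutations, and the bound χ ≤ 2 for connected ribbon graphs. -/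

namespace MultiOrientable

/-! ### Orbits of two permutations -/

/-! Counting. The Kronecker deltas force the indices to be constant along closed strands, so A(G) =
(λ / N^(3/2))^v N^F with F the number of closed strands (`sum_vertexTensor_propagator`). A jacket
has v vertices, 2v edges, and as faces the closed strands of its two remaining types. Every closed
strand lies in two jackets, so adding the three Euler characteristics gives ϖ = 3 + 3v/2 - F
(`degree_eq`), which is the claimed power of N. Genera are non-negative because v + f ≤ e + 2 for a
connected ribbon graph, orientable or not; this is proved with coefficients modulo two, where the
boundary of a boundary vanishes without any choice of orientation
(`sum_vertexToEdge_mul_faceToEdge`).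

Free energy. By Wick's theorem the n-th term of Z is a sum over all permutations of the 2n
half-edges, that is, over labelled graphs (`gaussianMean_interaction_pow`). Splitting off the
connected component of vertex 0 (`labelledSum_succ`) says exactly that Z' = Z L', where L is the
exponential generating series of connected labelled graphs; hence L = log Z. Orbit-stabilizer
(`card_isomorphic_mul_card_aut`) converts labelled graphs into isomorphism classes weighted by
1/s(G).

Degree zero. A melon insertion adds two vertices and three faces, so melonic graphs keep 2F = 3v +
6. Conversely, equality forces all three jacket bounds to be sharp, so F_c = v/2 + 1. The 2v edges
then give faces of type c an average length below four; their length is even, so one has length two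
and joins vertices x and y by two edges. Either x and y are joined by all four edges and G is the
elementary melon, or one can exchange two edges so as to create a third edge between x and y. That
exchange increases F_a and F_b beyond what a connected graph allows, so it disconnects G: G is a
connected sum of two smaller graphs, again of degree zero (`Connected.exists_connSum_iso`).
Induction, and the stability of melonic graphs under connected sums (`IsMelonic.connSum`), conclude.
-/

theorem apply_eq_of_mem_closure {X : Type u} {Y : Type v} {S : Set (Equiv.Perm X)} {f : X → Y}
    (h : ∀ g ∈ S, ∀ x, f (g x) = f x) {g : Equiv.Perm X} (hg : g ∈ Subgroup.closure S) (x : X) :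
    f (g x) = f x := by
  induction hg using Subgroup.closure_induction generalizing x with
  | mem g hg => exact h g hg x
  | one => rfl
  | mul g g' _ _ ih ih' => rw [Equiv.Perm.mul_apply, ih, ih']
  | inv g _ ih => simpa using (ih (g⁻¹ x)).symm

/-- The set of orbits of the group generated by two permutations. -/
abbrev Orbits {X : Type u} (α β : Equiv.Perm X) : Type u :=
  MulAction.orbitRel.Quotient (Subgroup.closure ({α, β} : Set (Equiv.Perm X))) X

namespace Orbits

variable {X : Type u} {Y : Type v} {α β : Equiv.Perm X}

variable (α β) in
/-- The orbit of an element. -/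
def mk (x : X) : Orbits α β := Quotient.mk'' x

theorem mk_eq_mk_of_mem {g : Equiv.Perm X}
    (hg : g ∈ Subgroup.closure ({α, β} : Set (Equiv.Perm X))) (x : X) :
    mk α β (g x) = mk α β x :=
  Quotient.sound' ⟨⟨g, hg⟩, rfl⟩

@[simp]
theorem mk_left (x : X) : mk α β (α x) = mk α β x :=
  mk_eq_mk_of_mem (Subgroup.subset_closure (by simp)) x

@[simp]
theorem mk_right (x : X) : mk α β (β x) = mk α β x :=
  mk_eq_mk_of_mem (Subgroup.subset_closure (by simp)) x

/-- The function on orbits induced by an invariant function. -/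
def lift (f : X → Y) (hα : ∀ x, f (α x) = f x) (hβ : ∀ x, f (β x) = f x) : Orbits α β → Y :=
  Quotient.lift f fun x y h => by
    obtain ⟨⟨g, hg⟩, rfl⟩ := h
    refine apply_eq_of_mem_closure (S := {α, β}) ?_ hg y
    rintro g (rfl | rfl)
    exacts [hα, hβ]

@[simp]
theorem lift_mk (f : X → Y) (hα : ∀ x, f (α x) = f x) (hβ : ∀ x, f (β x) = f x) (x : X) :
    lift f hα hβ (mk α β x) = f x := rfl

@[elab_as_elim]
theorem ind {P : Orbits α β → Prop} (h : ∀ x, P (mk α β x)) (o : Orbits α β) : P o :=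
  Quotient.ind h o

theorem apply_eq_of_mk_eq {f : X → Y} (hα : ∀ x, f (α x) = f x) (hβ : ∀ x, f (β x) = f x)
    {x y : X} (h : mk α β x = mk α β y) : f x = f y :=
  congrArg (lift f hα hβ) h

/-- A bijection that intertwines two pairs of permutations induces a bijection of the orbits. -/
def congr {γ δ : Equiv.Perm Y} (e : X ≃ Y) (h₁ : ∀ x, e (α x) = γ (e x))
    (h₂ : ∀ x, e (β x) = δ (e x)) : Orbits α β ≃ Orbits γ δ where
  toFun := lift (fun x => mk γ δ (e x)) (fun x => by rw [h₁, mk_left])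
    (fun x => by rw [h₂, mk_right])
  invFun := lift (fun y => mk α β (e.symm y))
    (fun y => by
      rw [← mk_left (e.symm y)]; congr 1; rw [Equiv.symm_apply_eq, h₁, Equiv.apply_symm_apply])
    (fun y => by
      rw [← mk_right (e.symm y)]; congr 1; rw [Equiv.symm_apply_eq, h₂, Equiv.apply_symm_apply])
  left_inv o := by induction o using ind with | h x => simp
  right_inv o := by induction o using ind with | h x => simp

instance [Finite X] : Finite (Orbits α β) := Quotient.finite _

/-- An invariant function is a free choice of one value per orbit. This is how a sum over indices
becomes N to the number of closed strands. -/
theorem orbitCount_eq_card_invariant [Finite X] (N : ℕ) :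
    N ^ orbitCount α β =
      Nat.card {f : X → Fin N // (∀ x, f (α x) = f x) ∧ ∀ x, f (β x) = f x} := by
  have : Nat.card (Orbits α β → Fin N) = N ^ orbitCount α β := by
    rw [Nat.card_fun, Nat.card_fin]; rfl
  rw [← this]
  exact Nat.card_congr
    { toFun := fun f => ⟨fun x => f (mk α β x), by simp, by simp⟩
      invFun := fun f => lift f.1 f.2.1 f.2.2
      left_inv := fun f => by ext o; induction o using ind with | h x => simp
      right_inv := fun f => by ext x; simp }

end Orbits

/-! ### The Euler bound for ribbon graphs -/

namespace RibbonGraph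

variable (R : RibbonGraph.{u})

/-- The coboundary from vertices to edges, modulo two. -/
def vertexToEdge :
    (Orbits R.side R.corner → ZMod 2) →ₗ[ZMod 2] (Orbits R.side R.edge → ZMod 2) where
  toFun f := Orbits.lift (fun x => f (Orbits.mk _ _ x) + f (Orbits.mk _ _ (R.edge x)))
    (fun x => by rw [← R.side_edge]; simp) (fun x => by rw [R.edge_edge, add_comm])
  map_add' f g := by
    ext o; induction o using Orbits.ind with | h x => simp; ring
  map_smul' c f := by
    ext o; induction o using Orbits.ind with | h x => simp; ring

/-- The boundary from faces to edges, modulo two. -/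
def faceToEdge :
    (Orbits R.corner R.edge → ZMod 2) →ₗ[ZMod 2] (Orbits R.side R.edge → ZMod 2) where
  toFun f := Orbits.lift (fun x => f (Orbits.mk _ _ x) + f (Orbits.mk _ _ (R.side x)))
    (fun x => by rw [R.side_side, add_comm]) (fun x => by rw [R.side_edge]; simp)
  map_add' f g := by
    ext o; induction o using Orbits.ind with | h x => simp; ring
  map_smul' c f := by
    ext o; induction o using Orbits.ind with | h x => simp; ring

variable {R}

theorem Connected.eq_of_invariant (hR : R.Connected) {Y : Type v} {f : R.Flag → Y}
    (h₁ : ∀ x, f (R.side x) = f x) (h₂ : ∀ x, f (R.corner x) = f x)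
    (h₃ : ∀ x, f (R.edge x) = f x) (x y : R.Flag) : f x = f y := by
  obtain ⟨⟨g, hg⟩, rfl⟩ := hR.2.exists_smul_eq y x
  refine apply_eq_of_mem_closure (S := {R.side, R.corner, R.edge}) ?_ hg y
  rintro g (rfl | rfl | rfl)
  exacts [h₁, h₂, h₃]

/-- Evaluation at one point is injective on constant functions. It is applied to the kernels of the
two boundary maps, whose elements are constant on a connected ribbon graph. -/
theorem finrank_le_one_of_forall_eq {ι : Type u} [Nonempty ι]
    (S : Submodule (ZMod 2) (ι → ZMod 2)) (h : ∀ f ∈ S, ∀ i j, f i = f j) :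
    Module.finrank (ZMod 2) S ≤ 1 := by
  obtain ⟨i⟩ := ‹Nonempty ι›
  have : Function.Injective ((LinearMap.proj i : (ι → ZMod 2) →ₗ[ZMod 2] ZMod 2) ∘ₗ S.subtype) := by
    intro f g hfg
    ext j
    rw [h f.1 f.2 j i, h g.1 g.2 j i]
    exact hfg
  simpa using LinearMap.finrank_le_finrank_of_injective this

/-- The boundary of a boundary vanishes modulo two. With F = f g on flags, the product at an edge
expands into the sum of F over its four flags, so the total is the sum of F over all flags. Since F
is invariant under the fixed-point-free involution `corner`, the terms cancel in pairs. -/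
theorem sum_vertexToEdge_mul_faceToEdge [Fintype R.Flag] [Fintype (Orbits R.side R.edge)]
    (f : Orbits R.side R.corner → ZMod 2) (g : Orbits R.corner R.edge → ZMod 2) :
    ∑ e, R.vertexToEdge f e * R.faceToEdge g e = 0 := by
  classical
  set F : R.Flag → ZMod 2 := fun x => f (Orbits.mk _ _ x) * g (Orbits.mk _ _ x) with hF
  have key : ∀ e, R.vertexToEdge f e * R.faceToEdge g e =
      ∑ x with Orbits.mk R.side R.edge x = e, F x := by
    intro e
    induction e using Orbits.ind with | h x =>
    have hfib : (Finset.univ.filter fun y => Orbits.mk R.side R.edge y = Orbits.mk _ _ x) =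
        {x, R.side x, R.edge x, R.side (R.edge x)} := by
      ext y
      simp only [Finset.mem_filter, Finset.mem_univ, true_and, Finset.mem_insert,
        Finset.mem_singleton]
      constructor
      · intro h
        let P : R.Flag → Prop := fun y => y = x ∨ y = R.side x ∨ y = R.edge x ∨
          y = R.side (R.edge x)
        have h₁ : ∀ y, P y → P (R.side y) := by
          rintro y (rfl | rfl | rfl | rfl) <;> simp [P, R.side_side]
        have h₂ : ∀ y, P y → P (R.edge y) := by
          rintro y (rfl | rfl | rfl | rfl) <;> simp [P, R.side_edge, R.edge_edge]
        have := Orbits.apply_eq_of_mk_eq (f := P)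
          (fun y => propext ⟨fun hy => R.side_side y ▸ h₁ _ hy, h₁ y⟩)
          (fun y => propext ⟨fun hy => R.edge_edge y ▸ h₂ _ hy, h₂ y⟩) h
        exact this.mpr (Or.inl rfl)
      · rintro (rfl | rfl | rfl | rfl) <;> simp
    have d₁ := R.side_ne x
    have d₂ := R.edge_ne x
    have d₃ := R.side_edge_ne x
    have d₄ : R.side x ≠ R.edge x := fun h => d₃ (by rw [← h, R.side_side])
    have d₅ : R.side x ≠ R.side (R.edge x) := fun h => d₂ (R.side.injective h).symm
    have d₆ := R.side_ne (R.edge x)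
    rw [hfib, Finset.sum_insert (by simp [d₁.symm, d₂.symm, d₃.symm]),
      Finset.sum_insert (by simp [d₄, d₅]), Finset.sum_insert (by simp [d₆.symm]),
      Finset.sum_singleton]
    have e₁ : Orbits.mk R.corner R.edge (R.side (R.edge x)) =
        Orbits.mk R.corner R.edge (R.side x) := by rw [R.side_edge]; simp
    simp only [hF, vertexToEdge, faceToEdge, LinearMap.coe_mk, AddHom.coe_mk, Orbits.lift_mk,
      Orbits.mk_left, Orbits.mk_right, e₁]
    ring
  rw [Finset.sum_congr rfl fun e _ => key e, Finset.sum_fiberwise]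
  refine Finset.sum_involution (fun x _ => R.corner x) (fun x _ => ?_) (fun x _ _ => R.corner_ne x)
    (fun x _ => Finset.mem_univ _) (fun x _ => R.corner_corner x)
  simp only [hF, Orbits.mk_left, Orbits.mk_right]
  exact CharTwo.add_self_eq_zero _

/-- The Euler characteristic of a connected ribbon graph is at most two. -/
theorem Connected.numVertices_add_numFaces_le [Finite R.Flag] (hR : R.Connected) :
    R.numVertices + R.numFaces ≤ R.numEdges + 2 := by
  classical
  obtain ⟨x₀⟩ := hR.1
  cases nonempty_fintype R.Flag
  have := Fintype.ofFinite (Orbits R.side R.edge)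
  have := Fintype.ofFinite (Orbits R.side R.corner)
  have := Fintype.ofFinite (Orbits R.corner R.edge)
  have : Nonempty (Orbits R.side R.corner) := ⟨Orbits.mk _ _ x₀⟩
  have : Nonempty (Orbits R.corner R.edge) := ⟨Orbits.mk _ _ x₀⟩
  -- Orthogonality of the two images bounds the sum of the ranks by e. By rank-nullity, with kernels
  -- of dimension at most one, the ranks are at least v - 1 and f - 1.
  have h₀ : (LinearMap.toMatrix' R.vertexToEdge).transpose *
      LinearMap.toMatrix' R.faceToEdge = 0 := by
    ext i j
    simp only [Matrix.mul_apply, Matrix.transpose_apply, LinearMap.toMatrix'_apply,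
      Matrix.zero_apply]
    exact sum_vertexToEdge_mul_faceToEdge _ _
  have h₁ := Matrix.rank_add_rank_le_card_of_mul_eq_zero h₀
  rw [Matrix.rank_transpose, Matrix.rank, Matrix.rank, ← Matrix.toLin'_apply',
    ← Matrix.toLin'_apply', Matrix.toLin'_toMatrix', Matrix.toLin'_toMatrix'] at h₁
  have h₂ := R.vertexToEdge.finrank_range_add_finrank_ker
  have h₃ := R.faceToEdge.finrank_range_add_finrank_ker
  have two : ∀ a b : ZMod 2, a + b = 0 → b = a := by decide
  have h₄ : Module.finrank (ZMod 2) (LinearMap.ker R.vertexToEdge) ≤ 1 := by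
    refine finrank_le_one_of_forall_eq _ fun f hf o o' => ?_
    induction o using Orbits.ind with | h x =>
    induction o' using Orbits.ind with | h y =>
    refine hR.eq_of_invariant (f := fun x => f (Orbits.mk _ _ x)) (by simp) (by simp)
      (fun x => ?_) x y
    exact two _ _ (congrFun hf (Orbits.mk _ _ x))
  have h₅ : Module.finrank (ZMod 2) (LinearMap.ker R.faceToEdge) ≤ 1 := by
    refine finrank_le_one_of_forall_eq _ fun f hf o o' => ?_
    induction o using Orbits.ind with | h x =>
    induction o' using Orbits.ind with | h y =>
    refine hR.eq_of_invariant (f := fun x => f (Orbits.mk _ _ x)) (fun x => ?_) (by simp)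
      (by simp) x y
    exact two _ _ (congrFun hf (Orbits.mk _ _ x))
  rw [Module.finrank_fintype_fun_eq_card] at h₂ h₃
  have e₁ : R.numVertices = Fintype.card (Orbits R.side R.corner) := Nat.card_eq_fintype_card
  have e₂ : R.numFaces = Fintype.card (Orbits R.corner R.edge) := Nat.card_eq_fintype_card
  have e₃ : R.numEdges = Fintype.card (Orbits R.side R.edge) := Nat.card_eq_fintype_card
  omega

theorem Connected.nonorientableGenus_nonneg [Finite R.Flag] (hR : R.Connected) :
    0 ≤ R.nonorientableGenus := by
  have := hR.numVertices_add_numFaces_le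
  unfold nonorientableGenus eulerChar
  omega

end RibbonGraph

end MultiOrientable

/-! ### Counting closed strands: jackets, connectedness, degree and amplitude. -/

namespace MultiOrientable

/-! ### Faces of multi-orientable graphs -/

theorem StrandType.sum_univ {M : Type*} [AddCommMonoid M] (f : StrandType → M) :
    ∑ t, f t = f .a + f .b + f .c := by
  have : (Finset.univ : Finset StrandType) = {.a, .b, .c} := rfl
  rw [this]
  simp [add_assoc]

/-- The permutation of the half-edges by the strands of type `t` at the vertices. -/
def vertexPerm (V : Type u) (t : StrandType) : Equiv.Perm (HalfEdge V) :=
  Function.Involutive.toPerm (vertexHalfEdge t) (vertexHalfEdge_vertexHalfEdge t)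

@[simp]
theorem vertexPerm_apply {V : Type u} (t : StrandType) (h : HalfEdge V) :
    vertexPerm V t h = vertexHalfEdge t h := rfl

/-- At a vertex the three strand involutions and the identity form a Klein four-group acting on the
four half-edges, so any two of them compose to the third. -/
theorem vertexHalfEdge_eq_comp {V : Type u} {s t : StrandType} (hs : s ≠ t) (h : HalfEdge V) :
    vertexHalfEdge t h = vertexHalfEdge s (vertexHalfEdge (t.third s) h) := by
  rcases t <;> rcases s <;> rcases h with ⟨x, i⟩ | ⟨x, i⟩ <;>
    simp_all [vertexHalfEdge, StrandType.third]

/-- The vertex of a half-edge. -/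
def HalfEdge.vertex {V : Type u} : HalfEdge V → V
  | .inl p => p.1
  | .inr p => p.1

@[simp]
theorem vertex_vertexHalfEdge {V : Type u} (t : StrandType) (h : HalfEdge V) :
    HalfEdge.vertex (vertexHalfEdge t h) = HalfEdge.vertex h := by
  rcases t <;> rcases h with ⟨x, i⟩ | ⟨x, i⟩ <;> rfl

/-- A function that is invariant under two types of strands at the vertices only depends on the
vertex. -/
theorem eq_of_vertexHalfEdge_invariant {V : Type u} {Y : Type v} {t : StrandType}
    {f : HalfEdge V → Y} (hf : ∀ s ≠ t, ∀ h, f (vertexHalfEdge s h) = f h) (h : HalfEdge V) :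
    f h = f (.inl (HalfEdge.vertex h, false)) := by
  have key : ∀ s h, f (vertexHalfEdge s h) = f h := by
    intro s h
    by_cases hs : s = t
    · subst hs
      obtain ⟨r, hr⟩ : ∃ r, r ≠ s := by
        cases s; exacts [⟨.b, by simp⟩, ⟨.a, by simp⟩, ⟨.a, by simp⟩]
      rw [vertexHalfEdge_eq_comp hr, hf r hr, hf _ (StrandType.third_ne_left hr)]
    · exact hf s hs h
  rcases h with ⟨x, _ | _⟩ | ⟨x, _ | _⟩
  · rfl
  · exact key .c (.inl (x, false))
  · exact key .a (.inl (x, false))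
  · exact key .b (.inl (x, false))

namespace MOGraph

section Faces

variable {V : Type u} (G : MOGraph V)

/-- The permutation of the half-edges that exchanges the two ends of each edge. -/
def partnerPerm : Equiv.Perm (HalfEdge V) :=
  Function.Involutive.toPerm G.partner G.partner_partner

@[simp]
theorem partnerPerm_apply (h : HalfEdge V) : G.partnerPerm h = G.partner h := rfl

/-- The faces of type `t`: the closed cycles formed by the strands of type `t`. -/
abbrev Face (t : StrandType) : Type u := Orbits (vertexPerm V t) G.partnerPerm

/-- The face of type `t` of a half-edge. -/
def face (t : StrandType) (h : HalfEdge V) : G.Face t := Orbits.mk _ _ h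

/-- The number of faces of type `t`. -/
noncomputable def faceCount (t : StrandType) : ℕ := orbitCount (vertexPerm V t) G.partnerPerm

@[simp]
theorem face_vertexHalfEdge (t : StrandType) (h : HalfEdge V) :
    G.face t (vertexHalfEdge t h) = G.face t h := Orbits.mk_left h

@[simp]
theorem face_partner (t : StrandType) (h : HalfEdge V) :
    G.face t (G.partner h) = G.face t h := Orbits.mk_right h

theorem face_inr_edge (t : StrandType) (p : V × Bool) :
    G.face t (.inr (G.edge p)) = G.face t (.inl p) := G.face_partner t (.inl p)

theorem faceCount_eq_card (t : StrandType) : G.faceCount t = Nat.card (G.Face t) := rfl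

/-! ### The jackets -/

/-- The number of all faces. -/
noncomputable def totalFaceCount : ℕ := ∑ t, G.faceCount t

variable (t : StrandType)

/-- `side` changes the strand type at a half-edge and `corner` then moves along either of the two
remaining types; these already reach all four half-edges. So a disc of the jacket is a vertex of the
graph. -/
theorem jacket_mk_vertex (h : HalfEdge V) (s r : {s : StrandType // s ≠ t}) :
    Orbits.mk (G.jacket t).side (G.jacket t).corner (h, s) =
      Orbits.mk (G.jacket t).side (G.jacket t).corner (.inl (HalfEdge.vertex h, false), r) := by
  have h₁ : ∀ (h : HalfEdge V) (s r : {s : StrandType // s ≠ t}),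
      Orbits.mk (G.jacket t).side (G.jacket t).corner (h, s) =
        Orbits.mk (G.jacket t).side (G.jacket t).corner (h, r) := by
    rintro h ⟨s, hs⟩ ⟨r, hr⟩
    by_cases hrs : r = s
    · subst hrs; rfl
    · have : r = t.third s := by
        revert hs hr hrs
        cases r <;> cases s <;> cases t <;> simp [StrandType.third]
      subst this
      exact (Orbits.mk_left (α := (G.jacket t).side) (β := (G.jacket t).corner)
        (h, ⟨s, hs⟩)).symm
  rw [eq_of_vertexHalfEdge_invariant (t := t)
    (f := fun h => Orbits.mk (G.jacket t).side (G.jacket t).corner (h, s)) (fun q hq h => ?_) h]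
  · exact h₁ _ _ _
  · rw [h₁ _ s ⟨q, hq⟩, h₁ _ s ⟨q, hq⟩]
    exact Orbits.mk_right (α := (G.jacket t).side) (β := (G.jacket t).corner) (h, ⟨q, hq⟩)

theorem exists_ne : ∃ s : StrandType, s ≠ t := by
  cases t
  exacts [⟨.b, by simp⟩, ⟨.a, by simp⟩, ⟨.a, by simp⟩]

theorem jacket_numVertices : (G.jacket t).numVertices = Nat.card V := by
  obtain ⟨s, hs⟩ := exists_ne t
  refine Nat.card_congr (α := Orbits (G.jacket t).side (G.jacket t).corner)
    { toFun := Orbits.lift (fun x => HalfEdge.vertex x.1) (fun _ => rfl)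
        (fun x => vertex_vertexHalfEdge _ _)
      invFun := fun x => Orbits.mk _ _ (.inl (x, false), ⟨s, hs⟩)
      left_inv := fun o => ?_
      right_inv := fun x => rfl }
  induction o using Orbits.ind with | h x => exact (G.jacket_mk_vertex t x.1 x.2 _).symm

theorem jacket_numEdges : (G.jacket t).numEdges = 2 * Nat.card V := by
  obtain ⟨s, hs⟩ := exists_ne t
  have : 2 * Nat.card V = Nat.card (V × Bool) := by simp [mul_comm]
  rw [this]
  refine Nat.card_congr (α := Orbits (G.jacket t).side (G.jacket t).edge)
    { toFun := Orbits.lift (fun x => Sum.elim id G.edge.symm x.1) (fun _ => rfl) ?_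
      invFun := fun p => Orbits.mk _ _ (.inl p, ⟨s, hs⟩)
      left_inv := fun o => ?_
      right_inv := fun x => rfl }
  · rintro ⟨p | p, q⟩
    · exact G.edge.symm_apply_apply p
    · rfl
  · induction o using Orbits.ind with | h x =>
    obtain ⟨h, r, hr⟩ := x
    have h₁ : ∀ h, Orbits.mk (G.jacket t).side (G.jacket t).edge (h, ⟨s, hs⟩) =
        Orbits.mk (G.jacket t).side (G.jacket t).edge (h, ⟨r, hr⟩) := by
      intro h
      by_cases hrs : r = s
      · subst hrs; rfl
      · have : r = t.third s := by
          revert hs hr hrs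
          cases r <;> cases s <;> cases t <;> simp [StrandType.third]
        subst this
        exact (Orbits.mk_left (α := (G.jacket t).side) (β := (G.jacket t).edge)
          (h, ⟨s, hs⟩)).symm
    rw [← h₁]
    rcases h with p | p
    · rfl
    · exact Orbits.mk_right (α := (G.jacket t).side) (β := (G.jacket t).edge)
          (.inr p, ⟨s, hs⟩)

/-- `corner` and `edge` both preserve the strand type, so an orbit is a strand type together with a
closed strand of that type. -/
theorem jacket_numFaces [Finite V] :
    (G.jacket t).numFaces = ∑ s : {s : StrandType // s ≠ t}, G.faceCount s := by
  have : ∑ s : {s : StrandType // s ≠ t}, G.faceCount s =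
      Nat.card (Σ s : {s : StrandType // s ≠ t}, G.Face s) := by
    rw [Nat.card_sigma]; rfl
  rw [this]
  refine Nat.card_congr (α := Orbits (G.jacket t).corner (G.jacket t).edge)
    { toFun := Orbits.lift (fun x => (⟨x.2, G.face _ x.1⟩ : Σ s : {s // s ≠ t}, G.Face s)) ?_ ?_
      invFun := fun z => Orbits.lift (fun h => Orbits.mk _ _ (h, z.1)) ?_ ?_ z.2
      left_inv := fun o => ?_
      right_inv := fun z => ?_ }
  · exact fun x => congrArg (Sigma.mk x.2) (G.face_vertexHalfEdge _ _)
  · exact fun x => congrArg (Sigma.mk x.2) (G.face_partner _ _)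
  · exact fun h => Orbits.mk_left (α := (G.jacket t).corner) (β := (G.jacket t).edge) (h, z.1)
  · exact fun h => Orbits.mk_right (α := (G.jacket t).corner) (β := (G.jacket t).edge) (h, z.1)
  · induction o using Orbits.ind with | h x => rfl
  · obtain ⟨s, o⟩ := z
    induction o using Orbits.ind with | h x => rfl

theorem jacket_numFaces_add [Finite V] :
    (G.jacket t).numFaces + G.faceCount t = G.totalFaceCount := by
  rw [jacket_numFaces, totalFaceCount, ← Finset.sum_erase_add _ _ (Finset.mem_univ t)]
  congr 1
  exact (Finset.sum_subtype (p := fun s => s ≠ t) (Finset.univ.erase t) (by simp)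
    (fun s => G.faceCount s)).symm

theorem jacket_eulerChar [Finite V] :
    (G.jacket t).eulerChar = G.totalFaceCount - G.faceCount t - Nat.card V := by
  have := G.jacket_numFaces_add t
  rw [RibbonGraph.eulerChar, jacket_numVertices, jacket_numEdges]
  push_cast
  omega

/-- Each jacket has χ = F - F_t - v, and every type is missing from exactly one jacket, so the three
values of χ add up to 2F - 3v. -/
theorem degree_eq [Finite V] :
    G.degree = 3 + 3 / 2 * (Nat.card V : ℚ) - G.totalFaceCount := by
  have h : G.totalFaceCount = G.faceCount .a + G.faceCount .b + G.faceCount .c :=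
    StrandType.sum_univ _
  rw [degree, StrandType.sum_univ]
  simp only [RibbonGraph.nonorientableGenus, jacket_eulerChar]
  rw [h]
  push_cast
  ring

end Faces

/-! ### Connectedness -/

section Connected

variable {V : Type u} (G : MOGraph V)

/-- A set of vertices that is a union of connected components. -/
def IsInvariant (S : Set V) : Prop := ∀ p : V × Bool, p.1 ∈ S ↔ (G.edge p).1 ∈ S

variable {G}

theorem IsInvariant.compl {S : Set V} (h : G.IsInvariant S) : G.IsInvariant Sᶜ :=
  fun p => not_congr (h p)

theorem IsInvariant.union {S T : Set V} (hS : G.IsInvariant S) (hT : G.IsInvariant T) :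
    G.IsInvariant (S ∪ T) :=
  fun p => or_congr (hS p) (hT p)

variable (G) in
/-- The graph of adjacencies between distinct vertices. -/
def adjGraph : SimpleGraph V := SimpleGraph.fromRel fun x y : V => ∃ i j, G.edge (x, i) = (y, j)

theorem IsInvariant.mem_iff_of_reachable {S : Set V} (h : G.IsInvariant S) {x y : V}
    (hxy : G.adjGraph.Reachable x y) : x ∈ S ↔ y ∈ S := by
  obtain ⟨w⟩ := hxy
  induction w with
  | nil => rfl
  | @cons u v _ hadj _ ih =>
    refine Iff.trans ?_ ih
    rcases (SimpleGraph.fromRel_adj _ _ _).mp hadj with ⟨-, ⟨i, j, hij⟩ | ⟨i, j, hij⟩⟩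
    · simpa [hij] using h (u, i)
    · simpa [hij] using (h (v, i)).symm

variable (G) in
/-- The connected component of a vertex. -/
def component (x : V) : Set V := {y | G.adjGraph.Reachable x y}

theorem mem_component_self (x : V) : x ∈ G.component x := SimpleGraph.Reachable.refl x

theorem isInvariant_component (x : V) : G.IsInvariant (G.component x) := by
  rintro ⟨y, i⟩
  have key : G.adjGraph.Reachable y (G.edge (y, i)).1 := by
    by_cases h : y = (G.edge (y, i)).1
    · rw [← h]
    · exact SimpleGraph.Adj.reachable
        ((SimpleGraph.fromRel_adj _ _ _).mpr ⟨h, Or.inl ⟨i, (G.edge (y, i)).2, rfl⟩⟩)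
  exact ⟨fun h => h.trans key, fun h => h.trans key.symm⟩

theorem IsInvariant.component_subset {S : Set V} (h : G.IsInvariant S) {x : V} (hx : x ∈ S) :
    G.component x ⊆ S :=
  fun _ hy => (h.mem_iff_of_reachable hy).mp hx

/-- Replaces paths by sets of vertices closed under edges, which transfer easily to jackets,
exchanges of edges and restrictions. -/
theorem connected_iff :
    G.Connected ↔ Nonempty V ∧ ∀ S : Set V, S.Nonempty → G.IsInvariant S → S = Set.univ := by
  constructor
  · intro h
    refine ⟨h.nonempty, fun S ⟨x, hx⟩ hS => Set.eq_univ_of_forall fun y => ?_⟩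
    exact (hS.mem_iff_of_reachable (h.preconnected x y)).mp hx
  · rintro ⟨hV, h⟩
    refine @SimpleGraph.Connected.mk _ _ (fun x y => ?_) hV
    have := h (G.component x) ⟨x, mem_component_self x⟩ (isInvariant_component x)
    exact (this ▸ Set.mem_univ y : y ∈ G.component x)

theorem connected_iff_component (x : V) : G.Connected ↔ G.component x = Set.univ := by
  rw [connected_iff]
  constructor
  · exact fun h => h.2 _ ⟨x, mem_component_self x⟩ (isInvariant_component x)
  · refine fun h => ⟨⟨x⟩, fun S ⟨y, hy⟩ hS => ?_⟩
    have hx : x ∈ S := (hS.mem_iff_of_reachable (h ▸ Set.mem_univ y : y ∈ G.component x)).mpr hy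
    exact Set.univ_subset_iff.mp (h ▸ hS.component_subset hx)

/-- The vertices whose flags lie in the orbit of a given flag form an invariant set, since all flags
at one vertex are equivalent and `edge` crosses to the neighbour. Connectedness of G makes it
everything. -/
theorem Connected.jacket (hG : G.Connected) (t : StrandType) : (G.jacket t).Connected := by
  classical
  obtain ⟨s, hs⟩ := exists_ne t
  obtain ⟨⟨x₀⟩, hc⟩ := connected_iff.mp hG
  refine ⟨⟨(.inl (x₀, false), ⟨s, hs⟩)⟩, ⟨fun z w => ?_⟩⟩
  let R := G.jacket t
  let Q := MulAction.orbitRel.Quotient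
    (Subgroup.closure ({R.side, R.corner, R.edge} : Set (Equiv.Perm R.Flag))) R.Flag
  let m : R.Flag → Q := fun x => Quotient.mk'' x
  have hm : ∀ g ∈ ({R.side, R.corner, R.edge} : Set (Equiv.Perm R.Flag)), ∀ x, m (g x) = m x :=
    fun g hg x => Quotient.sound' ⟨⟨g, Subgroup.subset_closure hg⟩, rfl⟩
  have h₁ : ∀ (h : HalfEdge V) (q r : {s : StrandType // s ≠ t}),
      m (h, q) = m (.inl (HalfEdge.vertex h, false), r) := fun h q r =>
    Orbits.apply_eq_of_mk_eq (hm _ (Or.inl rfl)) (hm _ (Or.inr (Or.inl rfl)))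
      (G.jacket_mk_vertex t h q r)
  have h₂ := hc {x | m (.inl (x, false), ⟨s, hs⟩) = m z} ⟨HalfEdge.vertex z.1, (h₁ z.1 z.2 _).symm⟩
    (fun p => by
      have h₃ : m (.inl p, ⟨s, hs⟩) = m (.inr (G.edge p), ⟨s, hs⟩) :=
        (hm R.edge (Or.inr (Or.inr rfl)) (.inl p, ⟨s, hs⟩)).symm
      rw [h₁ _ _ ⟨s, hs⟩, h₁ (.inr _) _ ⟨s, hs⟩] at h₃
      exact Eq.congr_left h₃)
  have h₄ : m w = m z := (h₁ w.1 w.2 ⟨s, hs⟩).trans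
    (h₂.ge (Set.mem_univ (HalfEdge.vertex w.1)))
  obtain ⟨g, hg⟩ := Quotient.exact' h₄
  exact ⟨g, hg⟩

instance (t : StrandType) [Finite V] : Finite (G.jacket t).Flag :=
  inferInstanceAs (Finite (HalfEdge V × {s : StrandType // s ≠ t}))

theorem Connected.nonorientableGenus_nonneg [Finite V] (hG : G.Connected) (t : StrandType) :
    0 ≤ (G.jacket t).nonorientableGenus :=
  (hG.jacket t).nonorientableGenus_nonneg

/-- Non-negative genus of one jacket: the closed strands of the two types other than t number at
most v + 2. Degree zero is the case of equality for all three types. -/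
theorem Connected.totalFaceCount_le [Finite V] (hG : G.Connected) (t : StrandType) :
    G.totalFaceCount ≤ Nat.card V + 2 + G.faceCount t := by
  have := hG.nonorientableGenus_nonneg t
  rw [RibbonGraph.nonorientableGenus, jacket_eulerChar] at this
  omega

theorem Connected.two_mul_totalFaceCount_le [Finite V] (hG : G.Connected) :
    2 * G.totalFaceCount ≤ 3 * Nat.card V + 6 := by
  have ha := hG.totalFaceCount_le .a
  have hb := hG.totalFaceCount_le .b
  have hc := hG.totalFaceCount_le .c
  have : G.totalFaceCount = G.faceCount .a + G.faceCount .b + G.faceCount .c :=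
    StrandType.sum_univ _
  omega

theorem Connected.degree_eq_div [Finite V] (hG : G.Connected) :
    G.degree = ((3 * Nat.card V + 6 - 2 * G.totalFaceCount : ℕ) : ℚ) / 2 := by
  rw [degree_eq, Nat.cast_sub hG.two_mul_totalFaceCount_le]
  push_cast
  ring

theorem degree_eq_zero_iff [Finite V] :
    G.degree = 0 ↔ 2 * G.totalFaceCount = 3 * Nat.card V + 6 := by
  rw [degree_eq, ← Nat.cast_inj (R := ℚ)]
  push_cast
  constructor <;> intro h <;> linarith

end Connected

/-! ### Amplitudes -/

section Amplitude

variable {V : Type u} (G : MOGraph V)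

/-- The indices of the half-edges, regrouped by the strands that carry them. -/
def strandIndexEquiv (V : Type u) (N : ℕ) :
    ((V × Bool → Index N) × (V × Bool → Index N)) ≃ (StrandType → HalfEdge V → Fin N) where
  toFun pq t h := match t, h with
    | .a, .inl r => (pq.1 r).2.2
    | .b, .inl r => (pq.1 r).1
    | .c, .inl r => (pq.1 r).2.1
    | .a, .inr r => (pq.2 r).1
    | .b, .inr r => (pq.2 r).2.2
    | .c, .inr r => (pq.2 r).2.1
  invFun f := (fun r => (f .b (.inl r), f .c (.inl r), f .a (.inl r)),
    fun r => (f .a (.inr r), f .c (.inr r), f .b (.inr r)))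
  left_inv pq := rfl
  right_inv f := by ext t h; cases t <;> cases h <;> rfl

open Classical in
-- The product of all deltas is the indicator that, for each strand type separately, the index is
-- invariant under the vertex strands and under the edges. The count of such assignments factors
-- over the three types.
theorem sum_vertexTensor_propagator [Fintype V] (N : ℕ) :
    ∑ p : V × Bool → Index N, ∑ q : V × Bool → Index N,
      (∏ x : V, vertexTensor (p (x, false)) (q (x, false)) (p (x, true)) (q (x, true))) *
        ∏ h : V × Bool, propagator (p h) (q (G.edge h)) = (N : ℂ) ^ G.totalFaceCount := by
  let P : (V × Bool → Index N) × (V × Bool → Index N) → Prop := fun pq =>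
    ∀ t, (∀ h, strandIndexEquiv V N pq t (vertexPerm V t h) = strandIndexEquiv V N pq t h) ∧
      ∀ h, strandIndexEquiv V N pq t (G.partnerPerm h) = strandIndexEquiv V N pq t h
  have h₁ : ∀ pq : (V × Bool → Index N) × (V × Bool → Index N),
      (∏ x : V, vertexTensor (pq.1 (x, false)) (pq.2 (x, false)) (pq.1 (x, true))
        (pq.2 (x, true))) * ∏ h : V × Bool, propagator (pq.1 h) (pq.2 (G.edge h)) =
      if P pq then (1 : ℂ) else 0 := by
    intro pq
    have hP : P pq ↔ (∀ x : V, (pq.1 (x, false)).2.2 = (pq.2 (x, false)).1 ∧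
        (pq.2 (x, false)).2.2 = (pq.1 (x, true)).1 ∧ (pq.1 (x, true)).2.2 = (pq.2 (x, true)).1 ∧
        (pq.2 (x, true)).2.2 = (pq.1 (x, false)).1 ∧
        (pq.1 (x, false)).2.1 = (pq.1 (x, true)).2.1 ∧
        (pq.2 (x, false)).2.1 = (pq.2 (x, true)).2.1) ∧
        ∀ h : V × Bool, (pq.1 h).1 = (pq.2 (G.edge h)).2.2 ∧
          (pq.1 h).2.1 = (pq.2 (G.edge h)).2.1 ∧ (pq.1 h).2.2 = (pq.2 (G.edge h)).1 := by
      constructor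
      · intro h
        refine ⟨fun x => ⟨?_, ?_, ?_, ?_, ?_, ?_⟩, fun r => ⟨?_, ?_, ?_⟩⟩
        · exact (h .a).1 (.inr (x, false))
        · exact (h .b).1 (.inl (x, true))
        · exact (h .a).1 (.inr (x, true))
        · exact (h .b).1 (.inl (x, false))
        · exact (h .c).1 (.inl (x, true))
        · exact (h .c).1 (.inr (x, true))
        · exact ((h .b).2 (.inl r)).symm
        · exact ((h .c).2 (.inl r)).symm
        · exact ((h .a).2 (.inl r)).symm
      · rintro ⟨h, h'⟩ t
        constructor
        · cases t <;> rintro (⟨x, _ | _⟩ | ⟨x, _ | _⟩) <;>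
            simp [strandIndexEquiv, vertexHalfEdge, h x]
        · cases t <;> rintro (r | r) <;>
            simp [strandIndexEquiv, partner, h']
    simp only [vertexTensor, propagator, Finset.prod_ite_zero, Finset.prod_const_one]
    simp only [Finset.mem_univ, true_imp_iff, ← ite_and, mul_ite, mul_one, mul_zero]
    split_ifs with h h' h'
    · rfl
    · exact absurd (hP.mpr ⟨h.2, h.1⟩) h'
    · exact absurd ⟨(hP.mp h').2, (hP.mp h').1⟩ h
    · rfl
  rw [← Fintype.sum_prod_type', Finset.sum_congr rfl fun pq _ => h₁ pq, Finset.sum_boole,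
    totalFaceCount, ← Finset.prod_pow_eq_pow_sum]
  have h₂ : ∀ t, (N : ℂ) ^ G.faceCount t = (Nat.card {f : HalfEdge V → Fin N //
      (∀ x, f (vertexPerm V t x) = f x) ∧ ∀ x, f (G.partnerPerm x) = f x} : ℕ) := by
    intro t
    rw [← Orbits.orbitCount_eq_card_invariant]
    push_cast; rfl
  rw [Finset.prod_congr rfl fun t _ => h₂ t, ← Nat.cast_prod, ← Nat.card_pi,
    ← Fintype.card_subtype, ← Nat.card_eq_fintype_card]
  congr 1
  refine Nat.card_congr (Equiv.trans (Equiv.subtypeEquiv (strandIndexEquiv V N) fun pq => ?_)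
    (Equiv.subtypePiEquivPi (p := fun (t : StrandType) (f : HalfEdge V → Fin N) =>
      (∀ x, f (vertexPerm V t x) = f x) ∧
      ∀ x, f (G.partnerPerm x) = f x)))
  rfl

theorem amplitude_eq [Fintype V] (lam : ℂ) (N : ℕ) :
    amplitude G lam N = (lam / (scaling N : ℂ)) ^ Nat.card V * (N : ℂ) ^ G.totalFaceCount := by
  rw [← sum_vertexTensor_propagator, Nat.card_eq_fintype_card, amplitude]

theorem amplitude_eq_degree [Fintype V] (lam : ℂ) {N : ℕ} (hN : 1 ≤ N) :
    amplitude G lam N =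
      lam ^ Fintype.card V * (((N : ℝ) ^ (3 - (G.degree : ℝ)) : ℝ) : ℂ) := by
  have hN' : (0 : ℝ) < N := by exact_mod_cast hN
  rw [amplitude_eq, div_pow, Nat.card_eq_fintype_card, div_mul_eq_mul_div, mul_div_assoc]
  congr 1
  have h : (3 - (G.degree : ℝ)) = G.totalFaceCount - 3 / 2 * (Fintype.card V : ℝ) := by
    rw [degree_eq, Nat.card_eq_fintype_card]
    push_cast
    ring
  rw [h, Real.rpow_sub hN', Real.rpow_natCast, Real.rpow_mul hN'.le, Real.rpow_natCast, ← scaling]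
  push_cast
  rfl

end Amplitude

end MOGraph

end MultiOrientable

/-! ### Isomorphisms, exchanges of edges, disjoint unions and restrictions. -/

namespace MultiOrientable

namespace MOGraph

/-! ### Isomorphisms -/

section Iso

variable {V : Type u} {W : Type v} {G : MOGraph V} {H : MOGraph W}

/-- The action of an isomorphism on the half-edges `φ`, and on the half-edges `φ̂`. -/
def Iso.toEquiv (f : Iso G H) : V × Bool ≃ W × Bool where
  toFun p := (f.vertex p.1, xor p.2 (f.flip p.1))
  invFun q := (f.vertex.symm q.1, xor q.2 (f.flip (f.vertex.symm q.1)))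
  left_inv p := by simp
  right_inv q := by simp

theorem Iso.toEquiv_apply (f : Iso G H) (p : V × Bool) :
    f.toEquiv p = (f.vertex p.1, xor p.2 (f.flip p.1)) := rfl

theorem Iso.edge_toEquiv (f : Iso G H) (p : V × Bool) :
    H.edge (f.toEquiv p) = f.toEquiv (G.edge p) := f.edge_comm p

theorem Iso.edge_symm_toEquiv (f : Iso G H) (p : V × Bool) :
    H.edge.symm (f.toEquiv p) = f.toEquiv (G.edge.symm p) := by
  rw [Equiv.symm_apply_eq, f.edge_toEquiv, Equiv.apply_symm_apply]

theorem Iso.faceCount_eq (f : Iso G H) (t : StrandType) : G.faceCount t = H.faceCount t := by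
  refine Nat.card_congr (Orbits.congr (Equiv.sumCongr f.toEquiv f.toEquiv) ?_ ?_)
  · cases t <;> rintro (⟨x, i⟩ | ⟨x, i⟩) <;> simp [vertexHalfEdge, Iso.toEquiv_apply]
  · rintro (p | p) <;> simp [partner, f.edge_toEquiv, f.edge_symm_toEquiv]

theorem Iso.totalFaceCount_eq (f : Iso G H) : G.totalFaceCount = H.totalFaceCount :=
  Finset.sum_congr rfl fun t _ => f.faceCount_eq t

theorem Iso.connected (f : Iso G H) (hG : G.Connected) : H.Connected := by
  obtain ⟨⟨x⟩, h⟩ := connected_iff.mp hG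
  refine connected_iff.mpr ⟨⟨f.vertex x⟩, fun S hS hinv => ?_⟩
  have := h (f.vertex ⁻¹' S) (hS.preimage f.vertex.surjective) fun p => by
    have := hinv (f.toEquiv p)
    rwa [f.edge_toEquiv] at this
  rwa [Set.preimage_eq_univ_iff, f.vertex.surjective.range_eq, Set.univ_subset_iff] at this

theorem Iso.connected_iff (f : Iso G H) : G.Connected ↔ H.Connected :=
  ⟨f.connected, f.symm.connected⟩

/-- Equal graphs are isomorphic. -/
def Iso.ofEq {G G' : MOGraph V} (h : G = G') : Iso G G' where
  vertex := Equiv.refl V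
  flip _ := false
  edge_comm p := by subst h; simp

end Iso

/-! ### Exchanging the ends of two edges -/

section Swap

variable {V : Type u} {W : Type v} {X : Type w}

open Classical in
/-- The graph obtained by cutting two edges and joining the four open half-edges crosswise. -/
noncomputable def swapEdge (G : MOGraph V) (p q : V × Bool) : MOGraph V where
  edge := (Equiv.swap p q).trans G.edge

theorem swapEdge_edge [DecidableEq (V × Bool)] (G : MOGraph V) (p q r : V × Bool) :
    (G.swapEdge p q).edge r = G.edge (Equiv.swap p q r) := by
  rw [swapEdge, Equiv.trans_apply]
  congr!

theorem swapEdge_edge_symm [DecidableEq (V × Bool)] (G : MOGraph V) (p q r : V × Bool) :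
    (G.swapEdge p q).edge.symm r = Equiv.swap p q (G.edge.symm r) := by
  rw [Equiv.symm_apply_eq, swapEdge_edge, Equiv.swap_apply_self, Equiv.apply_symm_apply]

theorem swapEdge_edge_left (G : MOGraph V) (p q : V × Bool) :
    (G.swapEdge p q).edge p = G.edge q := by
  classical rw [swapEdge_edge, Equiv.swap_apply_left]

theorem swapEdge_edge_right (G : MOGraph V) (p q : V × Bool) :
    (G.swapEdge p q).edge q = G.edge p := by
  classical rw [swapEdge_edge, Equiv.swap_apply_right]

theorem swapEdge_edge_of_ne (G : MOGraph V) {p q r : V × Bool} (hp : r ≠ p) (hq : r ≠ q) :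
    (G.swapEdge p q).edge r = G.edge r := by
  classical rw [swapEdge_edge, Equiv.swap_apply_of_ne_of_ne hp hq]

theorem swapEdge_comm (G : MOGraph V) (p q : V × Bool) : G.swapEdge p q = G.swapEdge q p := by
  ext1; simp only [swapEdge, Equiv.swap_comm]

theorem swapEdge_self_swapEdge (G : MOGraph V) (p q : V × Bool) :
    (G.swapEdge p q).swapEdge p q = G := by
  classical ext1; ext1 r; simp [swapEdge_edge]

/-- Conjugating a transposition relabels the points it exchanges; the relabelling matters when the
two exchanges share a half-edge. -/
theorem swapEdge_swapEdge [DecidableEq (V × Bool)] (G : MOGraph V) (a b p q : V × Bool) :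
    (G.swapEdge a b).swapEdge p q =
      (G.swapEdge p q).swapEdge (Equiv.swap p q a) (Equiv.swap p q b) := by
  ext1; ext1 r
  simp only [swapEdge_edge]
  rw [← Equiv.swap_apply_self p q (Equiv.swap a b _), Equiv.swap_apply_self]
  congr 1
  rw [Equiv.swap_apply_apply]
  simp

/-- An isomorphism is compatible with exchanging the ends of edges. -/
noncomputable def Iso.swapEdge {G : MOGraph V} {H : MOGraph W} (f : Iso G H) (p q : V × Bool) :
    Iso (G.swapEdge p q) (H.swapEdge (f.toEquiv p) (f.toEquiv q)) where
  vertex := f.vertex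
  flip := f.flip
  edge_comm r := by
    classical
    have h := f.edge_toEquiv (Equiv.swap p q r)
    rw [← f.toEquiv.injective.swap_apply] at h
    rw [← f.toEquiv_apply, swapEdge_edge, h, ← swapEdge_edge]
    rfl

/-! ### Disjoint unions -/

/-- The half-edges of the first graph, in a disjoint union. -/
def inlHalf (p : V × Bool) : (V ⊕ W) × Bool := (.inl p.1, p.2)

/-- The half-edges of the second graph, in a disjoint union. -/
def inrHalf (p : W × Bool) : (V ⊕ W) × Bool := (.inr p.1, p.2)

theorem inlHalf_injective : Function.Injective (inlHalf : V × Bool → (V ⊕ W) × Bool) := by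
  rintro ⟨x, i⟩ ⟨y, j⟩ h; simpa [inlHalf] using h

theorem inrHalf_injective : Function.Injective (inrHalf : W × Bool → (V ⊕ W) × Bool) := by
  rintro ⟨x, i⟩ ⟨y, j⟩ h; simpa [inrHalf] using h

theorem inlHalf_ne_inrHalf (p : V × Bool) (q : W × Bool) :
    (inlHalf p : (V ⊕ W) × Bool) ≠ inrHalf q := by
  simp [inlHalf, inrHalf]

variable (G : MOGraph V) (H : MOGraph W)

@[simp]
theorem disjointUnion_edge_inlHalf (p : V × Bool) :
    (G.disjointUnion H).edge (inlHalf p) = inlHalf (G.edge p) := rfl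

@[simp]
theorem disjointUnion_edge_inrHalf (p : W × Bool) :
    (G.disjointUnion H).edge (inrHalf p) = inrHalf (H.edge p) := rfl

@[simp]
theorem disjointUnion_edge_inl (x : V) (i : Bool) :
    (G.disjointUnion H).edge (.inl x, i) = inlHalf (G.edge (x, i)) := rfl

@[simp]
theorem disjointUnion_edge_inr (x : W) (i : Bool) :
    (G.disjointUnion H).edge (.inr x, i) = inrHalf (H.edge (x, i)) := rfl

@[simp]
theorem disjointUnion_edge_symm_inl (x : V) (i : Bool) :
    (G.disjointUnion H).edge.symm (.inl x, i) = inlHalf (G.edge.symm (x, i)) := rfl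

@[simp]
theorem disjointUnion_edge_symm_inr (x : W) (i : Bool) :
    (G.disjointUnion H).edge.symm (.inr x, i) = inrHalf (H.edge.symm (x, i)) := rfl

/-- The half-edges of a disjoint union. -/
def halfEdgeSumEquiv (V : Type u) (W : Type v) : HalfEdge (V ⊕ W) ≃ HalfEdge V ⊕ HalfEdge W where
  toFun
    | .inl (.inl x, i) => .inl (.inl (x, i))
    | .inl (.inr x, i) => .inr (.inl (x, i))
    | .inr (.inl x, i) => .inl (.inr (x, i))
    | .inr (.inr x, i) => .inr (.inr (x, i))
  invFun
    | .inl (.inl p) => .inl (inlHalf p)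
    | .inl (.inr p) => .inr (inlHalf p)
    | .inr (.inl p) => .inl (inrHalf p)
    | .inr (.inr p) => .inr (inrHalf p)
  left_inv := by rintro (⟨_ | _, _⟩ | ⟨_ | _, _⟩) <;> rfl
  right_inv := by rintro ((_ | _) | (_ | _)) <;> rfl

theorem halfEdgeSumEquiv_vertexHalfEdge (t : StrandType) (h : HalfEdge (V ⊕ W)) :
    halfEdgeSumEquiv V W (vertexHalfEdge t h) =
      Sum.map (vertexHalfEdge t) (vertexHalfEdge t) (halfEdgeSumEquiv V W h) := by
  cases t <;> rcases h with ⟨x | x, i⟩ | ⟨x | x, i⟩ <;> rfl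

theorem faceCount_disjointUnion [Finite V] [Finite W] (t : StrandType) :
    (G.disjointUnion H).faceCount t = G.faceCount t + H.faceCount t := by
  simp only [faceCount_eq_card]
  rw [← Nat.card_sum]
  refine Nat.card_congr
    { toFun := Orbits.lift (fun h => Sum.map (G.face t) (H.face t) (halfEdgeSumEquiv V W h)) ?_ ?_
      invFun := Sum.elim
        (Orbits.lift (fun h => face _ t ((halfEdgeSumEquiv V W).symm (.inl h))) ?_ ?_)
        (Orbits.lift (fun h => face _ t ((halfEdgeSumEquiv V W).symm (.inr h))) ?_ ?_)
      left_inv := fun o => ?_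
      right_inv := fun o => ?_ }
  · intro h
    rw [vertexPerm_apply, halfEdgeSumEquiv_vertexHalfEdge]
    cases halfEdgeSumEquiv V W h <;> simp
  · rintro (⟨x | x, i⟩ | ⟨x | x, i⟩)
    · exact congrArg Sum.inl (G.face_partner t (.inl (x, i)))
    · exact congrArg Sum.inr (H.face_partner t (.inl (x, i)))
    · exact congrArg Sum.inl (G.face_partner t (.inr (x, i)))
    · exact congrArg Sum.inr (H.face_partner t (.inr (x, i)))
  · intro h
    rw [← (G.disjointUnion H).face_vertexHalfEdge]
    cases t <;> rcases h with ⟨x, i⟩ | ⟨x, i⟩ <;>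
      simp [halfEdgeSumEquiv, vertexHalfEdge, inlHalf, -face_vertexHalfEdge]
  · intro h
    rw [← (G.disjointUnion H).face_partner]
    rcases h with ⟨x, i⟩ | ⟨x, i⟩ <;>
      simp [halfEdgeSumEquiv, partner, inlHalf, -face_partner]
  · intro h
    rw [← (G.disjointUnion H).face_vertexHalfEdge]
    cases t <;> rcases h with ⟨x, i⟩ | ⟨x, i⟩ <;>
      simp [halfEdgeSumEquiv, vertexHalfEdge, inrHalf, -face_vertexHalfEdge]
  · intro h
    rw [← (G.disjointUnion H).face_partner]
    rcases h with ⟨x, i⟩ | ⟨x, i⟩ <;>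
      simp [halfEdgeSumEquiv, partner, inrHalf, -face_partner]
  · induction o using Orbits.ind with | h x =>
    rcases x with ⟨x | x, i⟩ | ⟨x | x, i⟩ <;> rfl
  · rcases o with o | o <;> induction o using Orbits.ind with | h x =>
    rcases x with ⟨x, i⟩ | ⟨x, i⟩ <;> rfl

theorem totalFaceCount_disjointUnion [Finite V] [Finite W] :
    (G.disjointUnion H).totalFaceCount = G.totalFaceCount + H.totalFaceCount := by
  simp only [totalFaceCount, faceCount_disjointUnion, Finset.sum_add_distrib]

variable {G H}

/-- The disjoint union of two isomorphisms. -/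
def Iso.disjointUnionCongr {V' : Type*} {W' : Type*} {G' : MOGraph V'} {H' : MOGraph W'}
    (f : Iso G G') (g : Iso H H') : Iso (G.disjointUnion H) (G'.disjointUnion H') where
  vertex := Equiv.sumCongr f.vertex g.vertex
  flip := Sum.elim f.flip g.flip
  edge_comm := by
    rintro ⟨x | x, i⟩
    · have := f.edge_comm (x, i)
      simp_all [inlHalf]
    · have := g.edge_comm (x, i)
      simp_all [inrHalf]

variable (G H)

/-- Commutativity of the disjoint union. -/
def Iso.disjointUnionComm : Iso (G.disjointUnion H) (H.disjointUnion G) where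
  vertex := Equiv.sumComm V W
  flip _ := false
  edge_comm := by
    rintro ⟨x | x, i⟩ <;> simp [inlHalf, inrHalf]

/-- Associativity of the disjoint union. -/
def Iso.disjointUnionAssoc (K : MOGraph X) :
    Iso ((G.disjointUnion H).disjointUnion K) (G.disjointUnion (H.disjointUnion K)) where
  vertex := Equiv.sumAssoc V W X
  flip _ := false
  edge_comm := by
    rintro ⟨(x | x) | x, i⟩ <;> simp [inlHalf, inrHalf]

theorem swap_inlHalf [DecidableEq (V × Bool)] [DecidableEq ((V ⊕ W) × Bool)] (p q r : V × Bool) :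
    Equiv.swap (inlHalf p : (V ⊕ W) × Bool) (inlHalf q) (inlHalf r) = inlHalf (Equiv.swap p q r) :=
  inlHalf_injective.swap_apply p q r

theorem swap_inrHalf [DecidableEq (W × Bool)] [DecidableEq ((V ⊕ W) × Bool)] (p q r : W × Bool) :
    Equiv.swap (inrHalf p : (V ⊕ W) × Bool) (inrHalf q) (inrHalf r) = inrHalf (Equiv.swap p q r) :=
  inrHalf_injective.swap_apply p q r

theorem swapEdge_disjointUnion (p q : V × Bool) :
    (G.swapEdge p q).disjointUnion H = (G.disjointUnion H).swapEdge (inlHalf p) (inlHalf q) := by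
  classical
  ext1; ext1 ⟨x | x, i⟩
  · conv_rhs => rw [swapEdge_edge]
    change inlHalf ((G.swapEdge p q).edge (x, i)) = _
    rw [swapEdge_edge, ← disjointUnion_edge_inlHalf G H, ← swap_inlHalf]
    rfl
  · rw [swapEdge_edge, Equiv.swap_apply_of_ne_of_ne (by simp [inlHalf]) (by simp [inlHalf])]
    rfl

theorem disjointUnion_swapEdge (p q : W × Bool) :
    G.disjointUnion (H.swapEdge p q) = (G.disjointUnion H).swapEdge (inrHalf p) (inrHalf q) := by
  classical
  ext1; ext1 ⟨x | x, i⟩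
  · rw [swapEdge_edge, Equiv.swap_apply_of_ne_of_ne (by simp [inrHalf]) (by simp [inrHalf])]
    rfl
  · conv_rhs => rw [swapEdge_edge]
    change inrHalf ((H.swapEdge p q).edge (x, i)) = _
    rw [swapEdge_edge, ← disjointUnion_edge_inrHalf G H, ← swap_inrHalf]
    rfl

end Swap

/-! ### Restriction to connected components -/

section Restrict

variable {V : Type u} {G : MOGraph V} {S : Set V}

variable (G) in
/-- The restriction to a union of connected components. -/
def restrict (hS : G.IsInvariant S) : MOGraph S where
  edge :=
    { toFun := fun p => (⟨(G.edge (p.1, p.2)).1, (hS (p.1, p.2)).mp p.1.2⟩, (G.edge (p.1, p.2)).2)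
      invFun := fun p => (⟨(G.edge.symm (p.1, p.2)).1, by
        rw [hS]; simp⟩, (G.edge.symm (p.1, p.2)).2)
      left_inv := fun p => by simp
      right_inv := fun p => by simp }

open Classical in
/-- A graph is the disjoint union of its restrictions to a union of connected components and to the
complement. -/
noncomputable def disjointUnionRestrictIso (hS : G.IsInvariant S) :
    Iso ((G.restrict hS).disjointUnion (G.restrict hS.compl)) G where
  vertex := Equiv.Set.sumCompl S
  flip _ := false
  edge_comm := by
    rintro ⟨x | x, i⟩ <;> simp [inlHalf, inrHalf, restrict]

theorem IsInvariant.image_val (hS : G.IsInvariant S) {T : Set S}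
    (hT : (G.restrict hS).IsInvariant T) : G.IsInvariant (Subtype.val '' T) := by
  intro p
  constructor
  · rintro ⟨x, hx, hxp⟩
    exact ⟨_, (hT (x, p.2)).mp hx, by simp [restrict, hxp]⟩
  · rintro ⟨x, hx, hxp⟩
    have hp : p.1 ∈ S := by rw [hS, ← hxp]; exact x.2
    refine ⟨⟨p.1, hp⟩, (hT (⟨p.1, hp⟩, p.2)).mpr ?_, rfl⟩
    convert hx
    exact Subtype.ext hxp.symm

theorem IsInvariant.preimage_val (hS : G.IsInvariant S) {T : Set V} (hT : G.IsInvariant T) :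
    (G.restrict hS).IsInvariant (Subtype.val ⁻¹' T) := fun p => hT (p.1, p.2)

theorem connected_restrict_iff (hS : G.IsInvariant S) {x : V} (hx : x ∈ S) :
    (G.restrict hS).Connected ↔ G.component x = S := by
  rw [connected_iff]
  constructor
  · rintro ⟨-, h⟩
    refine (hS.component_subset hx).antisymm fun y hy => ?_
    have := h _ ⟨⟨x, hx⟩, mem_component_self x⟩ (hS.preimage_val (isInvariant_component x))
    exact this.ge (Set.mem_univ ⟨y, hy⟩)
  · refine fun h => ⟨⟨⟨x, hx⟩⟩, fun T ⟨y, hy⟩ hT => Set.eq_univ_of_forall fun z => ?_⟩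
    have hT' := hS.image_val hT
    have hmem : ∀ w : S, x ∈ Subtype.val '' T ↔ w ∈ T := fun w => by
      rw [hT'.mem_iff_of_reachable (h.ge w.2 : w.1 ∈ G.component x)]
      exact Subtype.val_injective.mem_set_image
    exact (hmem z).mp ((hmem y).mpr hy)

theorem disjointUnion_isInvariant {W : Type v} (G : MOGraph V) (H : MOGraph W) :
    (G.disjointUnion H).IsInvariant (Set.range Sum.inl) := by
  rintro ⟨x | x, i⟩ <;> simp [inlHalf, inrHalf]

end Restrict

end MOGraph

end MultiOrientable

/-! ### Effect of an exchange on the faces, connected sums, and stability of melonic graphs. -/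

namespace MultiOrientable

namespace MOGraph

/-! ### Faces and exchanges of edges -/

section FaceSwap

variable {V : Type u} {G : MOGraph V} {t : StrandType}

/-- Closure in one direction suffices because both moves are involutions. -/
theorem face_eq_face_iff_of_forall {P : HalfEdge V → Prop}
    (h₁ : ∀ h, P h → P (vertexHalfEdge t h)) (h₂ : ∀ h, P h → P (G.partner h))
    {h h' : HalfEdge V} (hh : G.face t h = G.face t h') : P h ↔ P h' :=
  iff_of_eq (Orbits.apply_eq_of_mk_eq (f := P)
    (fun x => propext ⟨fun hx => by
      have := h₁ _ hx; rwa [vertexPerm_apply, vertexHalfEdge_vertexHalfEdge] at this, h₁ x⟩)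
    (fun x => propext ⟨fun hx => by
      have := h₂ _ hx; rwa [partnerPerm_apply, partner_partner] at this, h₂ x⟩) hh)

theorem IsInvariant.face_ne {S : Set V} (hS : G.IsInvariant S) {h h' : HalfEdge V}
    (hh : HalfEdge.vertex h ∈ S) (hh' : HalfEdge.vertex h' ∉ S) : G.face t h ≠ G.face t h' := by
  intro heq
  refine hh' ((face_eq_face_iff_of_forall (P := fun h => HalfEdge.vertex h ∈ S) ?_ ?_ heq).mp hh)
  · intro h hh
    rwa [vertex_vertexHalfEdge]
  · rintro (p | p) hp
    · exact (hS p).mp hp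
    · refine (hS _).mpr ?_
      rwa [Equiv.apply_symm_apply]

/-- Once the face of p is identified with that of q, the old faces label the half-edges consistently
with the new edges. So the new faces surject onto the old ones, except possibly the face of p. -/
theorem faceCount_le_faceCount_swapEdge_add_one [Finite V] (p q : V × Bool) :
    G.faceCount t ≤ (G.swapEdge p q).faceCount t + 1 := by
  classical
  let g : HalfEdge V → G.Face t := fun h =>
    if G.face t h = G.face t (.inl p) then G.face t (.inl q) else G.face t h
  have hs : ∀ r, g (.inl (Equiv.swap p q r)) = g (.inl r) := by
    intro r
    rw [Equiv.swap_apply_def]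
    split_ifs with h₁ h₂
    · subst h₁; simp [g]
    · subst h₂; simp [g]
    · rfl
  have hp : ∀ h, g (G.partner h) = g h := fun h => by simp [g]
  have hp' : ∀ h, g ((G.swapEdge p q).partner h) = g h := by
    rintro (r | r)
    · rw [partner, swapEdge_edge, ← hs r, ← hp (.inl (Equiv.swap p q r))]; rfl
    · rw [partner, swapEdge_edge_symm, hs, ← hp (.inr r)]; rfl
  let F : Option ((G.swapEdge p q).Face t) → G.Face t := fun o =>
    o.elim (G.face t (.inl p)) (Orbits.lift g (fun h => by simp [g]) hp')
  have hF : Function.Surjective F := by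
    intro o
    induction o using Orbits.ind with | h h =>
    by_cases hh : G.face t h = G.face t (.inl p)
    · exact ⟨none, hh.symm⟩
    · exact ⟨some ((G.swapEdge p q).face t h), if_neg hh⟩
  simpa [Finite.card_option, faceCount_eq_card] using Nat.card_le_card_of_surjective F hF

/-- A parity argument. If p and q stayed on different faces, let f be the indicator of the
half-edges lying on both the old and the new face of p. Pairing half-edges along the vertex strands
makes the sum of f even. Pairing them along the old edges, every edge contributes an even number
except the one at p, which contributes one. -/
theorem swapEdge_face_eq_of_face_ne [Finite V] {p q : V × Bool}
    (h : G.face t (.inl p) ≠ G.face t (.inl q)) :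
    (G.swapEdge p q).face t (.inl p) = (G.swapEdge p q).face t (.inl q) := by
  classical
  by_contra hne
  cases nonempty_fintype V
  let f : HalfEdge V → ZMod 2 := fun h =>
    if (G.swapEdge p q).face t h = (G.swapEdge p q).face t (.inl p) ∧
      G.face t h = G.face t (.inl p) then 1 else 0
  have h₀ : ∑ h, f h = 0 := by
    refine Finset.sum_involution (fun h _ => vertexHalfEdge t h) (fun h _ => ?_)
      (fun h _ _ => vertexHalfEdge_ne t h) (fun h _ => Finset.mem_univ _)
      (fun h _ => vertexHalfEdge_vertexHalfEdge t h)
    simp only [f, face_vertexHalfEdge]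
    exact CharTwo.add_self_eq_zero _
  rw [Fintype.sum_sum_type, ← Equiv.sum_comp G.edge fun r => f (.inr r),
    ← Finset.sum_add_distrib, Finset.sum_eq_single p] at h₀
  · have e : (G.swapEdge p q).face t (.inr (G.edge p)) = (G.swapEdge p q).face t (.inl q) := by
      rw [← face_inr_edge, swapEdge_edge_right]
    simp [f, face_inr_edge, e, Ne.symm hne] at h₀
  · intro r _ hr
    by_cases hq : r = q
    · subst hq
      simp [f, face_inr_edge, h.symm]
    · have e : (G.swapEdge p q).face t (.inr (G.edge r)) = (G.swapEdge p q).face t (.inl r) := by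
        rw [← face_inr_edge, swapEdge_edge_of_ne _ hr hq]
      simp only [f, face_inr_edge, e]
      exact CharTwo.add_self_eq_zero _
  · simp

/-- As p and q share a face after the exchange, the new face is constant along old faces. The
induced surjection of old faces onto new ones identifies the faces of p and q. -/
theorem faceCount_swapEdge_add_one_le [Finite V] {p q : V × Bool}
    (h : G.face t (.inl p) ≠ G.face t (.inl q)) :
    (G.swapEdge p q).faceCount t + 1 ≤ G.faceCount t := by
  classical
  have heq := swapEdge_face_eq_of_face_ne h
  have hs : ∀ r, (G.swapEdge p q).face t (.inl (Equiv.swap p q r)) =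
      (G.swapEdge p q).face t (.inl r) := by
    intro r
    rw [Equiv.swap_apply_def]
    split_ifs with h₁ h₂
    · rw [h₁, heq]
    · rw [h₂, heq]
    · rfl
  let F : G.Face t → (G.swapEdge p q).Face t :=
    Orbits.lift (fun h => (G.swapEdge p q).face t h) (by simp) (by
      rintro (r | r)
      · rw [partnerPerm_apply, partner, ← hs r, ← face_inr_edge, swapEdge_edge,
          Equiv.swap_apply_self]
      · rw [partnerPerm_apply, partner, ← hs, ← swapEdge_edge_symm]
        exact face_partner _ _ (.inr r))
  have hF : Function.Surjective F := by
    intro o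
    induction o using Orbits.ind with | h h => exact ⟨G.face t h, rfl⟩
  have := Fintype.ofFinite (G.Face t)
  have := Fintype.ofFinite ((G.swapEdge p q).Face t)
  simp only [faceCount_eq_card, Nat.card_eq_fintype_card]
  exact Fintype.card_lt_of_surjective_not_injective F hF fun hinj => h (hinj heq)

theorem faceCount_add_one_le_swapEdge [Finite V] {p q : V × Bool}
    (h : (G.swapEdge p q).face t (.inl p) ≠ (G.swapEdge p q).face t (.inl q)) :
    G.faceCount t + 1 ≤ (G.swapEdge p q).faceCount t := by
  have := faceCount_swapEdge_add_one_le h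
  rwa [swapEdge_self_swapEdge] at this

theorem two_le_faceCount [Finite V] (g : HalfEdge V → Bool) (hg : Function.Surjective g)
    (h₁ : ∀ h, g (vertexHalfEdge t h) = g h) (h₂ : ∀ h, g (G.partner h) = g h) :
    2 ≤ G.faceCount t := by
  have : Function.Surjective (Orbits.lift g h₁ h₂ : G.Face t → Bool) := fun b =>
    (hg b).imp' (G.face t) fun _ h => h
  simpa [faceCount_eq_card] using Nat.card_le_card_of_surjective _ this

end FaceSwap

/-! ### Connected sums -/

section ConnSum

variable {V : Type u} {W : Type v} {X : Type w}

/-- The graph obtained by cutting an edge in each of two graphs and joining the four open half-edges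
crosswise. -/
noncomputable def connSum (G : MOGraph V) (H : MOGraph W) (p : V × Bool) (q : W × Bool) :
    MOGraph (V ⊕ W) :=
  (G.disjointUnion H).swapEdge (inlHalf p) (inrHalf q)

theorem insertMelon_eq_connSum (G : MOGraph V) (p : V × Bool) :
    G.insertMelon p = G.connSum elementaryMelon p (false, false) := by
  classical
  ext1
  simp only [insertMelon, connSum, swapEdge, inlHalf, inrHalf]
  congr!

/-- The two cut edges lie in different components, hence on different faces of every type; joining
them merges exactly one pair of faces of each type. -/
theorem faceCount_connSum [Finite V] [Finite W] (G : MOGraph V) (H : MOGraph W) (p : V × Bool)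
    (q : W × Bool) (t : StrandType) :
    (G.connSum H p q).faceCount t + 1 = G.faceCount t + H.faceCount t := by
  rw [← faceCount_disjointUnion]
  refine le_antisymm (faceCount_swapEdge_add_one_le ?_)
    (faceCount_le_faceCount_swapEdge_add_one _ _)
  exact (disjointUnion_isInvariant G H).face_ne ⟨p.1, rfl⟩ (by simp [HalfEdge.vertex, inrHalf])

theorem totalFaceCount_connSum [Finite V] [Finite W] (G : MOGraph V) (H : MOGraph W)
    (p : V × Bool) (q : W × Bool) :
    (G.connSum H p q).totalFaceCount + 3 = G.totalFaceCount + H.totalFaceCount := by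
  have := G.faceCount_connSum H p q
  simp only [totalFaceCount, StrandType.sum_univ]
  linarith [this .a, this .b, this .c]

/-- The connected sum of two isomorphisms. -/
noncomputable def Iso.connSumCongr {V' : Type*} {W' : Type*} {G : MOGraph V} {H : MOGraph W}
    {G' : MOGraph V'} {H' : MOGraph W'} (f : Iso G G') (g : Iso H H') (p : V × Bool)
    (q : W × Bool) :
    Iso (G.connSum H p q) (G'.connSum H' (f.toEquiv p) (g.toEquiv q)) :=
  (f.disjointUnionCongr g).swapEdge _ _

/-- Commutativity of the connected sum. -/
noncomputable def Iso.connSumComm (G : MOGraph V) (H : MOGraph W) (p : V × Bool) (q : W × Bool) :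
    Iso (G.connSum H p q) (H.connSum G q p) :=
  ((Iso.disjointUnionComm G H).swapEdge _ _).trans (Iso.ofEq (by
    rw [swapEdge_comm]
    simp [connSum, Iso.toEquiv_apply, Iso.disjointUnionComm, inlHalf, inrHalf]))

open Classical in
/-- Associativity of the connected sum. -/
noncomputable def Iso.connSumAssoc (G : MOGraph V) (H : MOGraph W) (K : MOGraph X) (p : V × Bool)
    (q r : W × Bool) (s : X × Bool) :
    Iso ((G.connSum H p q).connSum K (Equiv.swap (inlHalf p) (inrHalf q) (inrHalf r)) s)
      (G.connSum (H.connSum K r s) p (inlHalf q)) :=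
  (Iso.ofEq (by rw [connSum, connSum, swapEdge_disjointUnion])).trans
    ((((Iso.disjointUnionAssoc G H K).swapEdge _ _).swapEdge _ _).trans (Iso.ofEq (by
      -- The two exchanges are performed in opposite orders on the two sides. Commuting them
      -- conjugates one by the other, whence the transposed half-edge in the statement; it differs
      -- from `inrHalf r` only when r = q.
      rw [connSum, connSum, disjointUnion_swapEdge,
        swapEdge_swapEdge _ (inrHalf (inlHalf r)) (inrHalf (inrHalf s))]
      have e₁ : (Iso.disjointUnionAssoc G H K).toEquiv (inlHalf (inlHalf p)) = inlHalf p := by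
        simp [Iso.toEquiv_apply, Iso.disjointUnionAssoc, inlHalf]
      have e₂ : ∀ q, (Iso.disjointUnionAssoc G H K).toEquiv (inlHalf (inrHalf q)) =
          inrHalf (inlHalf q) := fun q => by
        simp [Iso.toEquiv_apply, Iso.disjointUnionAssoc, inlHalf, inrHalf]
      have e₃ : (Iso.disjointUnionAssoc G H K).toEquiv (inrHalf s) =
          inrHalf (inrHalf s) := by
        simp [Iso.toEquiv_apply, Iso.disjointUnionAssoc, inrHalf]
      have e₄ : ∀ z, (((Iso.disjointUnionAssoc G H K).swapEdge (inlHalf (inlHalf p))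
          (inlHalf (inrHalf q))).toEquiv z) = (Iso.disjointUnionAssoc G H K).toEquiv z :=
        fun _ => rfl
      rw [e₄, e₄, ← swap_inlHalf, ← Equiv.swap_apply_of_ne_of_ne (a := inlHalf (inlHalf p))
        (b := inlHalf (inrHalf q)) (x := inrHalf s) (inlHalf_ne_inrHalf _ _).symm
        (inlHalf_ne_inrHalf _ _).symm,
        ← (Iso.disjointUnionAssoc G H K).toEquiv.injective.swap_apply,
        ← (Iso.disjointUnionAssoc G H K).toEquiv.injective.swap_apply, e₁, e₂, e₂, e₃])))

end ConnSum

/-! ### Melonic graphs -/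

section Melonic

variable {V W : Type u}

theorem IsMelonic.of_iso {G : MOGraph V} {H : MOGraph W} (hG : G.IsMelonic) (f : Iso G H) :
    H.IsMelonic := by
  cases hG with
  | elementary _ h => exact .elementary _ (h.map fun g => g.trans f)
  | insertion G₀ p _ h₀ h => exact .insertion G₀ p _ h₀ (h.map fun g => g.trans f)

/-- The automorphisms of the melon act transitively on its half-edges φ, so it does not matter which
edge of the melon is cut. -/
theorem exists_elementaryMelon_iso (q : Bool × Bool) :
    ∃ f : Iso elementaryMelon elementaryMelon, f.toEquiv q = (false, false) :=
  ⟨{ vertex := ⟨fun x => xor q.1 x, fun x => xor q.1 x, fun x => by simp, fun x => by simp⟩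
     flip := fun _ => q.2
     edge_comm := fun p => by simp [elementaryMelon] }, by simp [Iso.toEquiv_apply]⟩

@[simp]
theorem Iso.refl_toEquiv (G : MOGraph V) (p : V × Bool) : (Iso.refl G).toEquiv p = p := by
  simp [Iso.toEquiv_apply, Iso.refl]

theorem Iso.toEquiv_symm_toEquiv {V : Type v} {W : Type w} {G : MOGraph V} {H : MOGraph W}
    (f : Iso G H) (p : W × Bool) : f.toEquiv (f.symm.toEquiv p) = p := by
  simp [Iso.toEquiv_apply, Iso.symm]

theorem IsMelonic.connSum_elementaryMelon {G : MOGraph V} (hG : G.IsMelonic) (p : V × Bool)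
    (q : Bool × Bool) : (G.connSum elementaryMelon p q).IsMelonic := by
  obtain ⟨f, hf⟩ := exists_elementaryMelon_iso q
  refine .insertion G p _ hG ⟨?_⟩
  have := (Iso.refl G).connSumCongr f p q
  rw [hf, Iso.refl_toEquiv, ← insertMelon_eq_connSum] at this
  exact this.symm

/-- Connected sums of melonic graphs are melonic. -/
theorem IsMelonic.connSum {H : MOGraph W} (hH : H.IsMelonic) :
    ∀ {V : Type u} {G : MOGraph V}, G.IsMelonic → ∀ (p : V × Bool) (q : W × Bool),
      (G.connSum H p q).IsMelonic := by
  induction hH with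
  | elementary H h =>
    obtain ⟨f⟩ := h
    intro V G hG p q
    have := (Iso.refl G).connSumCongr f p (f.symm.toEquiv q)
    rw [f.toEquiv_symm_toEquiv, Iso.refl_toEquiv] at this
    exact (hG.connSum_elementaryMelon p (f.symm.toEquiv q)).of_iso this
  | @insertion W₀ W H₀ r H _ h ih =>
    rw [insertMelon_eq_connSum] at h
    obtain ⟨f⟩ := h
    intro V G hG p q
    have e := (Iso.refl G).connSumCongr f p (f.symm.toEquiv q)
    rw [f.toEquiv_symm_toEquiv, Iso.refl_toEquiv] at e
    refine IsMelonic.of_iso ?_ e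
    obtain ⟨w | b, i⟩ := f.symm.toEquiv q
    -- The cut edge starts in H₀: sum G with H₀ first, then insert the melon.
    · exact ((ih hG p (w, i)).connSum_elementaryMelon _ _).of_iso
        (Iso.connSumAssoc G H₀ elementaryMelon p (w, i) r (false, false))
    -- The cut edge starts in the melon: insert the melon into G first, then sum with H₀. This is
    -- why the induction keeps G arbitrary.
    · have e := (Iso.refl G).connSumCongr
        (Iso.connSumComm elementaryMelon H₀ (false, false) r) p (inlHalf (b, i))
      rw [Iso.refl_toEquiv] at e
      refine ((ih (hG.connSum_elementaryMelon p (b, i)) _ r).of_iso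
        (Iso.connSumAssoc G elementaryMelon H₀ p (b, i) (false, false) r)).of_iso (e.trans ?_)
      refine Iso.ofEq (congrArg _ ?_)
      exact Prod.ext rfl (Bool.xor_false i)

end Melonic

end MOGraph

end MultiOrientable

/-! ### Degree zero characterizes melonic graphs. -/

namespace MultiOrientable

namespace MOGraph

section DegreeZero

variable {V : Type u} {G : MOGraph V}

/-! ### Melonic graphs have degree zero -/

theorem elementaryMelon_connected : elementaryMelon.Connected := by
  refine connected_iff.mpr ⟨⟨false⟩, fun S ⟨x, hx⟩ hS => Set.eq_univ_of_forall fun y => ?_⟩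
  by_cases h : y = x
  · rwa [h]
  · have := (hS (x, false)).mp hx
    rwa [Bool.eq_not_iff.mpr h]

/-- For each type, a two-colouring of the half-edges that is constant along closed strands and takes
both values exhibits two faces. -/
theorem six_le_totalFaceCount_elementaryMelon : 6 ≤ elementaryMelon.totalFaceCount := by
  have ha : 2 ≤ elementaryMelon.faceCount .a :=
    two_le_faceCount (fun | .inl p => p.2 | .inr p => p.2) (fun b => ⟨.inl (b, b), rfl⟩)
      (by rintro (p | p) <;> rfl) (by rintro (p | p) <;> rfl)
  have hb : 2 ≤ elementaryMelon.faceCount .b :=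
    two_le_faceCount (fun | .inl p => xor p.1 p.2 | .inr p => xor (!p.1) p.2)
      (fun b => ⟨.inl (b, false), by simp⟩)
      (by rintro (p | p) <;> simp [vertexHalfEdge])
      (by rintro (p | p) <;> simp [partner, elementaryMelon])
  have hc : 2 ≤ elementaryMelon.faceCount .c :=
    two_le_faceCount (fun | .inl p => p.1 | .inr p => !p.1) (fun b => ⟨.inl (b, false), rfl⟩)
      (by rintro (p | p) <;> rfl)
      (by rintro (p | p) <;> simp [partner, elementaryMelon])
  rw [totalFaceCount, StrandType.sum_univ]
  omega

/-- The lower bound six meets the Euler bound 2F ≤ 3 · 2 + 6. -/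
theorem totalFaceCount_elementaryMelon : elementaryMelon.totalFaceCount = 6 := by
  have h := elementaryMelon_connected.two_mul_totalFaceCount_le
  have := six_le_totalFaceCount_elementaryMelon
  rw [Nat.card_eq_fintype_card, Fintype.card_bool] at h
  omega

/-- The cut edge is replaced by a path through both melon vertices, so an invariant set restricts to
an invariant set of G and contains the melon vertices exactly when it contains the start of the cut
edge. -/
theorem Connected.insertMelon (hG : G.Connected) (p : V × Bool) : (G.insertMelon p).Connected := by
  rw [insertMelon_eq_connSum]
  set q : (V ⊕ Bool) × Bool := inrHalf (false, false) with hq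
  set K := G.connSum elementaryMelon p (false, false) with hK
  have e₁ : K.edge (inlHalf p) = inrHalf (true, false) := swapEdge_edge_left _ _ _
  have e₂ : K.edge q = inlHalf (G.edge p) := swapEdge_edge_right _ _ _
  have e₃ : ∀ r, r ≠ p → K.edge (inlHalf r) = inlHalf (G.edge r) := fun r hr =>
    swapEdge_edge_of_ne _ (inlHalf_injective.ne hr) (inlHalf_ne_inrHalf _ _)
  have e₄ : K.edge (inrHalf (false, true)) = inrHalf (true, true) :=
    swapEdge_edge_of_ne _ (inlHalf_ne_inrHalf _ _).symm (inrHalf_injective.ne (by simp))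
  obtain ⟨⟨x⟩, hc⟩ := connected_iff.mp hG
  refine connected_iff.mpr ⟨⟨.inl x⟩, fun S hne hS => ?_⟩
  have s₁ : (Sum.inl p.1 : V ⊕ Bool) ∈ S ↔ Sum.inr true ∈ S := by
    have := hS (inlHalf p)
    rw [e₁] at this
    exact this
  have s₂ : (Sum.inr false : V ⊕ Bool) ∈ S ↔ Sum.inl (G.edge p).1 ∈ S := by
    have := hS q
    rw [e₂] at this
    exact this
  have s₄ : (Sum.inr false : V ⊕ Bool) ∈ S ↔ Sum.inr true ∈ S := by
    have := hS (inrHalf (false, true))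
    rw [e₄] at this
    exact this
  have hinv : G.IsInvariant (Sum.inl ⁻¹' S) := by
    intro r
    by_cases hr : r = p
    · subst hr
      exact s₁.trans (s₄.symm.trans s₂)
    · have := hS (inlHalf r)
      rw [e₃ r hr] at this
      exact this
  have hbool : ∀ b, (Sum.inr b : V ⊕ Bool) ∈ S ↔ Sum.inl p.1 ∈ S := by
    rintro (_ | _)
    · rw [s₄, s₁]
    · rw [s₁]
  have huniv : Sum.inl ⁻¹' S = (Set.univ : Set V) := by
    refine hc _ ?_ hinv
    obtain ⟨y | b, hy⟩ := hne
    · exact ⟨y, hy⟩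
    · exact ⟨p.1, (hbool b).mp hy⟩
  refine Set.eq_univ_of_forall ?_
  rintro (y | b)
  · exact huniv.ge (Set.mem_univ y)
  · exact (hbool b).mpr (huniv.ge (Set.mem_univ p.1))

/-- An insertion adds two vertices and 6 - 3 = 3 faces, so both sides of the equation grow by six.
-/
theorem IsMelonic.finite_and_connected_and_totalFaceCount_eq (hG : G.IsMelonic) :
    Finite V ∧ G.Connected ∧ 2 * G.totalFaceCount = 3 * Nat.card V + 6 := by
  induction hG with
  | elementary G h =>
    obtain ⟨f⟩ := h
    refine ⟨Finite.of_equiv _ f.vertex, f.connected elementaryMelon_connected, ?_⟩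
    rw [← f.totalFaceCount_eq, totalFaceCount_elementaryMelon, ← Nat.card_congr f.vertex]
    simp
  | insertion G p H _ h ih =>
    obtain ⟨f⟩ := h
    obtain ⟨hfin, hconn, htot⟩ := ih
    refine ⟨Finite.of_equiv _ f.vertex, f.connected (hconn.insertMelon p), ?_⟩
    have := totalFaceCount_connSum G elementaryMelon p (false, false)
    rw [← insertMelon_eq_connSum, f.totalFaceCount_eq, totalFaceCount_elementaryMelon] at this
    rw [← Nat.card_congr f.vertex, Nat.card_sum, Nat.card_eq_fintype_card (α := Bool),
      Fintype.card_bool]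
    omega

/-! ### Graphs of degree zero are melonic -/

/-- If a graph has sufficiently many faces of type `c`, one of them has length two. -/
theorem exists_face_length_two [Finite V] (h : Nat.card V < 2 * G.faceCount .c) :
    ∃ (x y : V) (ε : Bool), ∀ i, G.edge (x, i) = (y, xor i ε) := by
  classical
  by_contra! hcon
  cases nonempty_fintype V
  have := Fintype.ofFinite (G.Face .c)
  let bar : V × Bool → V × Bool := fun p => (p.1, !p.2)
  have bar_bar : ∀ p, bar (bar p) = p := fun p => by simp [bar]
  have bar_ne : ∀ p, bar p ≠ p := fun p hp => by simp [bar, Prod.ext_iff] at hp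
  -- A face of type c closes after two edges exactly when the two φ at a vertex are joined to the
  -- two φ̂ of one vertex; ε records the relative rotation.
  have hne : ∀ p, G.edge (bar p) ≠ bar (G.edge p) := by
    rintro ⟨x, i⟩ hp
    obtain ⟨j, hj⟩ := hcon x (G.edge (x, i)).1 (xor i (G.edge (x, i)).2)
    apply hj
    by_cases hij : j = i
    · subst hij
      simp
    · obtain rfl : j = !i := Bool.eq_not_iff.mpr hij
      simpa [bar] using hp
  let f : V × Bool → G.Face .c := fun p => G.face .c (.inl p)
  have hbar : ∀ p, f (bar p) = f p := fun p => G.face_vertexHalfEdge .c (.inl p)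
  have hbar' : ∀ p, f (G.edge.symm (bar (G.edge p))) = f p := fun p => by
    have h₁ := G.face_inr_edge .c (G.edge.symm (bar (G.edge p)))
    rw [Equiv.apply_symm_apply] at h₁
    exact h₁.symm.trans ((G.face_vertexHalfEdge .c (.inr (G.edge p))).trans (G.face_inr_edge .c p))
  -- Going along the face in both directions from p and its opposite gives four half-edges φ,
  -- distinct when no face has length two. With 2v half-edges φ in all, this gives 4 F_c ≤ 2v,
  -- against the hypothesis.
  have hfib : ∀ o ∈ (Finset.univ : Finset (G.Face .c)),
      4 ≤ (Finset.univ.filter fun p => f p = o).card := by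
    intro o _
    obtain ⟨p, rfl⟩ : ∃ p, f p = o := by
      induction o using Orbits.ind with | h h =>
      rcases h with p | p
      · exact ⟨p, rfl⟩
      · exact ⟨G.edge.symm p, G.face_partner .c (.inr p)⟩
    set u := G.edge.symm (bar (G.edge p)) with hu
    set w := G.edge.symm (bar (G.edge (bar p))) with hw
    have d₁ : p ≠ bar p := (bar_ne p).symm
    have d₂ : p ≠ u := fun h => by
      rw [hu, Equiv.eq_symm_apply] at h
      exact bar_ne _ h.symm
    have d₃ : bar p ≠ w := fun h => by
      have := bar_ne (G.edge (bar p))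
      rw [hw, Equiv.eq_symm_apply] at h
      exact this h.symm
    have d₄ : p ≠ w := fun h => by
      rw [hw, Equiv.eq_symm_apply] at h
      exact hne p (by rw [h, bar_bar])
    have d₅ : bar p ≠ u := fun h => by
      rw [hu, Equiv.eq_symm_apply] at h
      exact hne p h
    have d₆ : u ≠ w := fun h => by
      have h₁ := G.edge.symm.injective h
      have h₂ := congrArg bar h₁
      rw [bar_bar, bar_bar] at h₂
      exact d₁ (G.edge.injective h₂)
    have hsub : ({p, bar p, u, w} : Finset (V × Bool)) ⊆ Finset.univ.filter fun q => f q = f p := by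
      intro q hq
      simp only [Finset.mem_insert, Finset.mem_singleton] at hq
      simp only [Finset.mem_filter, Finset.mem_univ, true_and]
      rcases hq with rfl | rfl | rfl | rfl
      · rfl
      · exact hbar p
      · exact hbar' p
      · rw [hw, hbar', hbar]
    refine le_trans (le_of_eq ?_) (Finset.card_le_card hsub)
    rw [Finset.card_insert_of_notMem (by simp [d₁, d₂, d₄]),
      Finset.card_insert_of_notMem (by simp [d₃, d₅]),
      Finset.card_insert_of_notMem (by simp [d₆]), Finset.card_singleton]
  have h₁ := Finset.card_eq_sum_card_fiberwise (s := (Finset.univ : Finset (V × Bool)))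
    (f := f) (t := Finset.univ) (fun _ _ => Finset.mem_coe.mpr (Finset.mem_univ _))
  have h₂ := Finset.card_nsmul_le_sum _ _ _ hfib
  rw [← h₁, Finset.card_univ, Finset.card_univ, Fintype.card_prod, Fintype.card_bool,
    smul_eq_mul] at h₂
  rw [faceCount_eq_card, Nat.card_eq_fintype_card, Nat.card_eq_fintype_card] at h
  omega

/-- Exchanging the ends of the two edges attached to a face of type `c` of length two increases the
numbers of faces of types `a` and `b`. -/
theorem faceCount_add_one_le_swapEdge_of_face_length_two [Finite V] {x y : V} {ε : Bool}
    (hxy : x ≠ y) (h : ∀ i, G.edge (x, i) = (y, xor i ε)) {i : Bool} {p : V × Bool}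
    (hp : G.edge p = (x, i)) (hne : p ≠ (y, xor i ε)) :
    G.faceCount .a + 1 ≤ (G.swapEdge p (y, xor i ε)).faceCount .a ∧
      G.faceCount .b + 1 ≤ (G.swapEdge p (y, xor i ε)).faceCount .b := by
  have hpx : ∀ j, p ≠ (x, j) := by
    rintro j rfl
    rw [h j] at hp
    exact hxy (congrArg Prod.fst hp).symm
  set G' := G.swapEdge p (y, xor i ε) with hG'
  have e₁ : ∀ j, G'.edge (x, j) = (y, xor j ε) := fun j => by
    rw [hG', swapEdge_edge_of_ne _ (hpx j).symm (by simp [hxy]), h]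
  have e₂ : G'.edge (y, xor i ε) = (x, i) := by
    rw [hG', swapEdge_edge_right, hp]
  have e₃ : ∀ j, G'.edge.symm (y, xor j ε) = (x, j) := fun j => by
    rw [Equiv.symm_apply_eq, e₁]
  have e₄ : G'.edge.symm (x, i) = (y, xor i ε) := by rw [Equiv.symm_apply_eq, e₂]
  obtain ⟨k, hk⟩ : ∃ k, k = xor (!i) ε := ⟨_, rfl⟩
  have e₅ : G'.edge (x, !i) = (y, k) := by rw [e₁, hk]
  have e₆ : G'.edge.symm (y, k) = (x, !i) := by rw [hk, e₃]
  have e₇ : (!xor i ε) = k := by rw [hk]; cases i <;> cases ε <;> rfl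
  have e₈ : (!k) = xor i ε := by rw [← e₇, Bool.not_not]
  constructor
  · refine faceCount_add_one_le_swapEdge fun heq => ?_
    -- After the exchange x and y share a third edge, and these four half-edges form a whole face of
    -- type a. It contains (y, xor i ε) but not p, so the exchange has separated the two.
    have := (face_eq_face_iff_of_forall (P := fun z => z = .inl (x, i) ∨ z = .inr (x, i) ∨
      z = .inl (y, xor i ε) ∨ z = .inr (y, xor i ε)) ?_ ?_ heq).mpr (by simp)
    · simp [hpx, hne] at this
    · rintro z (rfl | rfl | rfl | rfl) <;> simp [vertexHalfEdge]
    · rintro z (rfl | rfl | rfl | rfl) <;> simp [partner, ← hG', e₁, e₂, e₃, e₄]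
  · refine faceCount_add_one_le_swapEdge fun heq => ?_
    -- The same for type b, whose short face uses the other edge from x to y.
    have := (face_eq_face_iff_of_forall (P := fun z => z = .inl (x, !i) ∨ z = .inr (x, i) ∨
      z = .inl (y, xor i ε) ∨ z = .inr (y, k)) ?_ ?_ heq).mpr (by simp)
    · simp [hpx, hne] at this
    · rintro z (rfl | rfl | rfl | rfl) <;> simp [vertexHalfEdge, e₇, e₈]
    · rintro z (rfl | rfl | rfl | rfl) <;> simp [partner, ← hG', e₂, e₄, e₅, e₆]

/-- If exchanging two edges disconnects a connected graph, then the graph is a connected sum of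
connected graphs. -/
theorem Connected.exists_connSum_iso [Finite V] (hG : G.Connected) {p q : V × Bool}
    (h : ¬ (G.swapEdge p q).Connected) :
    ∃ (S : Set V) (G₁ : MOGraph S) (G₂ : MOGraph (Sᶜ : Set V)) (p₁ : S × Bool)
      (p₂ : (Sᶜ : Set V) × Bool), G₁.Connected ∧ G₂.Connected ∧
        Nonempty (Iso (G₁.connSum G₂ p₁ p₂) G) := by
  classical
  set K := G.swapEdge p q with hK
  have hKG : K.swapEdge p q = G := swapEdge_self_swapEdge G p q
  -- Undoing the exchange only matters for sets separating p from q. Hence the components of p and q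
  -- in K differ, as K is not connected, and their union is everything, as G is connected.
  have hinv : ∀ S : Set V, K.IsInvariant S → (p.1 ∈ S ↔ q.1 ∈ S) → G.IsInvariant S := by
    intro S hS hpq r
    rw [← hKG, swapEdge_edge, ← hS]
    rw [Equiv.swap_apply_def]
    split_ifs with h₁ h₂
    · rw [h₁, hpq]
    · rw [h₂, hpq]
    · rfl
  obtain ⟨-, hc⟩ := connected_iff.mp hG
  have hS := isInvariant_component (G := K) p.1
  have hp : p.1 ∈ K.component p.1 := mem_component_self _
  have hq : q.1 ∉ K.component p.1 := fun hq =>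
    h ((connected_iff_component p.1).mpr (hc _ ⟨_, hp⟩ (hinv _ hS (iff_of_true hp hq))))
  have hT := isInvariant_component (G := K) q.1
  have hq' : q.1 ∈ K.component q.1 := mem_component_self _
  have hcomp : K.component q.1 = (K.component p.1)ᶜ := by
    refine (hS.compl.component_subset hq).antisymm fun x hx => ?_
    have := hc _ ⟨_, Or.inl hp⟩ (hinv _ (hS.union hT) (iff_of_true (Or.inl hp) (Or.inr hq')))
    exact (this.ge (Set.mem_univ x)).resolve_left hx
  refine ⟨K.component p.1, K.restrict hS, K.restrict hS.compl, (⟨p.1, hp⟩, p.2), (⟨q.1, hq⟩, q.2),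
    (connected_restrict_iff hS hp).mpr rfl, (connected_restrict_iff hS.compl hq).mpr hcomp, ⟨?_⟩⟩
  have := (disjointUnionRestrictIso hS).swapEdge (inlHalf (⟨p.1, hp⟩, p.2))
    (inrHalf (⟨q.1, hq⟩, q.2))
  refine this.trans (Iso.ofEq ?_)
  rw [← hKG]
  congr 1 <;> simp [Iso.toEquiv_apply, disjointUnionRestrictIso, inlHalf, inrHalf]

/-- Strong induction on v. A face of type c of length two yields either the whole elementary melon
or an exchange that splits the graph into two smaller ones, both again saturating the Euler bound.
-/
theorem Connected.isMelonic_of_totalFaceCount_eq (n : ℕ) : ∀ {V : Type u} [Finite V]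
    {G : MOGraph V}, Nat.card V = n → G.Connected → 2 * G.totalFaceCount = 3 * n + 6 →
      G.IsMelonic := by
  induction n using Nat.strong_induction_on with | h n ih =>
  intro V _ G hn hG htot
  have hsum : G.totalFaceCount = G.faceCount .a + G.faceCount .b + G.faceCount .c :=
    StrandType.sum_univ _
  have ha := hG.totalFaceCount_le .a
  have hb := hG.totalFaceCount_le .b
  have hc := hG.totalFaceCount_le .c
  -- The three jacket bounds give 2 F_t ≥ n + 2 for each type, in particular n < 2 F_c.
  obtain ⟨x, y, ε, h⟩ := exists_face_length_two (G := G) (by omega)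
  obtain ⟨-, hconn⟩ := connected_iff.mp hG
  have hxy : x ≠ y := by
    rintro rfl
    have h₁ : ({x} : Set V) = Set.univ := hconn _ ⟨x, rfl⟩ fun p => by
      constructor
      · rintro hp
        obtain rfl : p.1 = x := hp
        simp [h p.2]
      · intro hp
        have : p = (x, xor (G.edge p).2 ε) := G.edge.injective (by
          rw [h]; exact Prod.ext hp (by simp))
        rw [this]; rfl
    -- A single vertex is excluded by parity: 2F = 9 is impossible.
    have : Nat.card V = 1 := by
      rw [← Set.ncard_univ, ← h₁, Set.ncard_singleton]
    omega
  by_cases hcase : ∃ i, G.edge.symm (x, i) ≠ (y, xor i ε)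
  · obtain ⟨i, hi⟩ := hcase
    have hF := faceCount_add_one_le_swapEdge_of_face_length_two hxy h
      (G.edge.apply_symm_apply (x, i)) hi
    obtain ⟨S, G₁, G₂, p₁, p₂, hG₁, hG₂, ⟨f⟩⟩ := hG.exists_connSum_iso
      (p := G.edge.symm (x, i)) (q := (y, xor i ε)) (fun hcon => by
        -- F_a + F_b ≥ n + 2 before the exchange, hence at least n + 4 after it, while a connected
        -- graph allows at most n + 2.
        have := hcon.totalFaceCount_le .c
        rw [totalFaceCount, StrandType.sum_univ] at this
        omega)
    -- The bounds for the two parts add up to 3n + 12, which is 2F + 6 by `totalFaceCount_connSum`;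
    -- so both are equalities.
    have t₁ := hG₁.two_mul_totalFaceCount_le
    have t₂ := hG₂.two_mul_totalFaceCount_le
    have t := totalFaceCount_connSum G₁ G₂ p₁ p₂
    have hcard := Nat.card_congr f.vertex
    rw [Nat.card_sum] at hcard
    rw [f.totalFaceCount_eq] at t
    have pos₁ : 0 < Nat.card S := Finite.card_pos_iff.mpr ⟨p₁.1⟩
    have pos₂ : 0 < Nat.card (Sᶜ : Set V) := Finite.card_pos_iff.mpr ⟨p₂.1⟩
    exact ((ih _ (by omega) rfl hG₂ (by omega)).connSum
      (ih _ (by omega) rfl hG₁ (by omega)) p₁ p₂).of_iso f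
  -- All four edges at x lead to y, so connectedness leaves no other vertex; rotating y by ε gives
  -- the elementary melon.
  · push Not at hcase
    have h' : ∀ i, G.edge (y, xor i ε) = (x, i) := fun i => by
      rw [← hcase, Equiv.apply_symm_apply]
    have huniv : ({x, y} : Set V) = Set.univ := hconn _ ⟨x, Or.inl rfl⟩ fun p => by
      constructor
      · rintro (hp | hp)
        · have : p = (x, p.2) := Prod.ext hp rfl
          rw [this, h]; exact Or.inr rfl
        · have : p = (y, xor (xor p.2 ε) ε) := Prod.ext hp (by simp)
          rw [this, h']; exact Or.inl rfl
      · rintro (hp | hp)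
        · have : p = (y, xor (G.edge p).2 ε) := G.edge.injective (by
            rw [h']; exact Prod.ext hp rfl)
          rw [this]; exact Or.inr rfl
        · have : p = (x, xor (G.edge p).2 ε) := G.edge.injective (by
            rw [h]; exact Prod.ext hp (by simp))
          rw [this]; exact Or.inl rfl
    refine .elementary G ⟨{
      vertex := Equiv.ofBijective (fun b => cond b y x) ⟨?_, ?_⟩
      flip := fun b => cond b ε false
      edge_comm := ?_ }⟩
    · rintro (_ | _) (_ | _) <;> simp [hxy, hxy.symm]
    · intro z
      rcases (huniv.ge (Set.mem_univ z) : z = x ∨ z = y) with rfl | rfl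
      exacts [⟨false, rfl⟩, ⟨true, rfl⟩]
    · rintro ⟨_ | _, i⟩
      · change G.edge (x, xor i false) = (y, xor i ε)
        rw [Bool.xor_false, h]
      · change G.edge (y, xor i ε) = (x, xor i false)
        rw [Bool.xor_false, h']

theorem connected_and_degree_eq_zero_iff [Finite V] :
    (G.Connected ∧ G.degree = 0) ↔ G.IsMelonic := by
  rw [degree_eq_zero_iff]
  exact ⟨fun h => Connected.isMelonic_of_totalFaceCount_eq _ rfl h.1 h.2,
    fun h => h.finite_and_connected_and_totalFaceCount_eq.2⟩

end DegreeZero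

end MOGraph

end MultiOrientable

/-! ### Gaussian moments, Wick's theorem and the Feynman expansion. -/

namespace MultiOrientable

open MeasureTheory

/-! ### Gaussian integrals -/

/-- The density of the standard complex Gaussian measure, up to normalization. -/
noncomputable def gaussianWeight (z : ℂ) : ℂ := (Real.exp (-(1 / 2) * ‖z‖ ^ 2) : ℝ)

theorem integral_norm_pow_mul_exp (k : ℕ) :
    ∫ z : ℂ, ‖z‖ ^ k * Real.exp (-(1 / 2) * ‖z‖ ^ 2) =
      Real.pi * (1 / 2 : ℝ) ^ (-((k : ℝ) + 2) / 2) * Real.Gamma (((k : ℝ) + 2) / 2) := by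
  have hk : (-2 : ℝ) < k := by linarith [Nat.cast_nonneg (α := ℝ) k]
  have := Complex.integral_rpow_mul_exp_neg_mul_rpow (p := 2) (q := k) (b := 1 / 2) (by norm_num)
    hk (by norm_num)
  simp only [Real.rpow_natCast, Real.rpow_two] at this
  rw [this]
  congr 2
  ring

/-- The integral of a non-integrable function is zero by convention, whereas the closed formula is
positive. -/
theorem integrable_norm_pow_mul_exp (k : ℕ) :
    Integrable fun z : ℂ => ‖z‖ ^ k * Real.exp (-(1 / 2) * ‖z‖ ^ 2) := by
  by_contra h
  have h₁ := integral_norm_pow_mul_exp k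
  rw [integral_undef h] at h₁
  have h₂ : 0 < Real.Gamma (((k : ℝ) + 2) / 2) := Real.Gamma_pos_of_pos (by positivity)
  have h₃ : 0 < Real.pi * (1 / 2 : ℝ) ^ (-((k : ℝ) + 2) / 2) * Real.Gamma (((k : ℝ) + 2) / 2) := by
    positivity
  exact h₃.ne h₁

theorem integrable_gaussianWeight_mul (m n : ℕ) :
    Integrable fun z : ℂ => gaussianWeight z * (z ^ m * (starRingEnd ℂ) z ^ n) := by
  refine (integrable_norm_pow_mul_exp (m + n)).mono' ?_ (Filter.Eventually.of_forall fun z => ?_)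
  · refine Continuous.aestronglyMeasurable ?_
    unfold gaussianWeight
    fun_prop
  · simp only [gaussianWeight, norm_mul, norm_pow, RCLike.norm_conj, Complex.norm_real,
      Real.norm_eq_abs, Real.abs_exp]
    rw [← pow_add, mul_comm]

theorem integral_gaussianWeight_mul_of_ne {m n : ℕ} (h : m ≠ n) :
    ∫ z : ℂ, gaussianWeight z * (z ^ m * (starRingEnd ℂ) z ^ n) = 0 := by
  have hmn : ((m : ℝ) - n) ≠ 0 := sub_ne_zero.mpr (by exact_mod_cast h)
  -- This rotation preserves the measure and the weight and multiplies z^m z̄^n by exp(iπ) = -1.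
  let c : Circle := Circle.exp (Real.pi / (m - n))
  have hc : (c : ℂ) ^ m * (starRingEnd ℂ) (c : ℂ) ^ n = -1 := by
    rw [← Complex.exp_pi_mul_I, Circle.coe_exp, ← Complex.exp_conj, ← Complex.exp_nat_mul,
      ← Complex.exp_nat_mul, ← Complex.exp_add]
    congr 1
    have hmn' : ((m : ℂ) - n) ≠ 0 := by exact_mod_cast hmn
    simp only [map_mul, Complex.conj_I, Complex.conj_ofReal]
    push_cast
    field_simp
    ring
  have key := (rotation c).measurePreserving.integral_comp
    (rotation c).toHomeomorph.measurableEmbedding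
    (fun z : ℂ => gaussianWeight z * (z ^ m * (starRingEnd ℂ) z ^ n))
  have h₁ : ∀ z : ℂ, gaussianWeight (rotation c z) *
      ((rotation c z) ^ m * (starRingEnd ℂ) (rotation c z) ^ n) =
      -(gaussianWeight z * (z ^ m * (starRingEnd ℂ) z ^ n)) := by
    intro z
    have : gaussianWeight (rotation c z) = gaussianWeight z := by
      rw [gaussianWeight, LinearIsometryEquiv.norm_map, gaussianWeight]
    rw [this, rotation_apply, map_mul, mul_pow, mul_pow]
    linear_combination (gaussianWeight z * (z ^ m * (starRingEnd ℂ) z ^ n)) * hc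
  simp only [h₁, integral_neg] at key
  exact self_eq_neg.mp key.symm

theorem integral_gaussianWeight_mul_self (m : ℕ) :
    ∫ z : ℂ, gaussianWeight z * (z ^ m * (starRingEnd ℂ) z ^ m) =
      2 * Real.pi * 2 ^ m * m.factorial := by
  have h₁ : ∀ z : ℂ, gaussianWeight z * (z ^ m * (starRingEnd ℂ) z ^ m) =
      ((‖z‖ ^ (2 * m) * Real.exp (-(1 / 2) * ‖z‖ ^ 2) : ℝ) : ℂ) := by
    intro z
    rw [← mul_pow, Complex.mul_conj', gaussianWeight, ← pow_mul]
    push_cast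
    ring
  simp only [h₁]
  rw [integral_complex_ofReal, integral_norm_pow_mul_exp]
  have e₁ : ((2 * m : ℕ) + 2 : ℝ) / 2 = m + 1 := by push_cast; ring
  have e₂ : -((2 * m : ℕ) + 2 : ℝ) / 2 = -((m + 1 : ℕ) : ℝ) := by push_cast; ring
  rw [e₁, e₂, Real.Gamma_nat_eq_factorial, Real.rpow_neg (by norm_num), Real.rpow_natCast,
    one_div, inv_pow, inv_inv]
  push_cast
  ring

theorem integral_gaussianWeight_mul (m n : ℕ) :
    ∫ z : ℂ, gaussianWeight z * (z ^ m * (starRingEnd ℂ) z ^ n) =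
      if m = n then (2 * Real.pi * 2 ^ m * m.factorial : ℂ) else 0 := by
  split_ifs with h
  · rw [← h, integral_gaussianWeight_mul_self]
  · exact integral_gaussianWeight_mul_of_ne h

/-! ### Wick's theorem -/

section Wick

variable {X : Type u} {ι : Type v} [Fintype X] [Fintype ι] [DecidableEq X]

theorem prod_apply_eq_prod_pow {M : Type*} [CommMonoid M] (f : X → M) (p : ι → X) :
    ∏ i, f (p i) = ∏ x, f x ^ Fintype.card {i // p i = x} := by
  rw [← Finset.prod_fiberwise Finset.univ p]
  refine Finset.prod_congr rfl fun x _ => ?_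
  rw [Finset.prod_congr rfl (g := fun _ => f x) (fun i hi => by
    rw [(Finset.mem_filter.mp hi).2]), Finset.prod_const, Fintype.card_subtype]

/-- The number of permutations that match two families of points. -/
theorem card_perm_matching [DecidableEq ι] (p q : ι → X) :
    Fintype.card {σ : Equiv.Perm ι // ∀ i, p i = q (σ i)} =
      ∏ x, if Fintype.card {i // p i = x} = Fintype.card {i // q i = x} then
        (Fintype.card {i // p i = x}).factorial else 0 := by
  by_cases h : ∀ x, Fintype.card {i // p i = x} = Fintype.card {i // q i = x}
  · let σ₀ : Equiv.Perm ι := Equiv.ofFiberEquiv fun x => Fintype.equivOfCardEq (h x)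
    have hσ₀ : ∀ i, q (σ₀ i) = p i := Equiv.ofFiberEquiv_map _
    simp only [h, if_true]
    simp only [← h]
    rw [← DomMulAct.stabilizer_card]
    refine Fintype.card_congr (Equiv.subtypeEquiv (Equiv.mulLeft σ₀⁻¹) fun σ => ?_)
    rw [funext_iff]
    refine forall_congr' fun i => ?_
    have : p ((Equiv.mulLeft σ₀⁻¹ σ) i) = q (σ i) := by
      rw [← hσ₀]
      simp
    rw [Function.comp_apply, this, eq_comm]
  · obtain ⟨x, hx⟩ := not_forall.mp h
    rw [Finset.prod_eq_zero (Finset.mem_univ x) (if_neg hx), Fintype.card_eq_zero_iff]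
    refine ⟨fun ⟨σ, hσ⟩ => hx ?_⟩
    exact Fintype.card_congr (Equiv.subtypeEquiv σ fun i => by rw [hσ])

theorem gaussianWeight_monomial_eq (p q : ι → X) (φ : X → ℂ) :
    (∏ x, gaussianWeight (φ x)) * ((∏ i, φ (p i)) * ∏ i, (starRingEnd ℂ) (φ (q i))) =
      ∏ x, gaussianWeight (φ x) * (φ x ^ Fintype.card {i // p i = x} *
        (starRingEnd ℂ) (φ x) ^ Fintype.card {i // q i = x}) := by
  rw [prod_apply_eq_prod_pow φ p, prod_apply_eq_prod_pow (fun x => (starRingEnd ℂ) (φ x)) q,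
    ← Finset.prod_mul_distrib, ← Finset.prod_mul_distrib]

theorem integrable_gaussianWeight_monomial (p q : ι → X) :
    Integrable fun φ : X → ℂ => (∏ x, gaussianWeight (φ x)) *
      ((∏ i, φ (p i)) * ∏ i, (starRingEnd ℂ) (φ (q i))) := by
  simp only [gaussianWeight_monomial_eq]
  exact Integrable.fintype_prod (f := fun (x : X) (z : ℂ) => gaussianWeight z *
    (z ^ Fintype.card {i // p i = x} * (starRingEnd ℂ) z ^ Fintype.card {i // q i = x}))
    fun x => integrable_gaussianWeight_mul _ _

/-- Wick's theorem without an induction on pairings: the integral factors over the coordinates, and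
the one-variable moments 2^m m! (zero for unequal exponents) multiply to the number of matchings.
Each pair contributes a propagator 2. -/
theorem integral_gaussianWeight_monomial [DecidableEq ι] (p q : ι → X) :
    ∫ φ : X → ℂ, (∏ x, gaussianWeight (φ x)) *
      ((∏ i, φ (p i)) * ∏ i, (starRingEnd ℂ) (φ (q i))) =
      (2 * Real.pi) ^ Fintype.card X * 2 ^ Fintype.card ι *
        Fintype.card {σ : Equiv.Perm ι // ∀ i, p i = q (σ i)} := by
  simp only [gaussianWeight_monomial_eq]
  rw [integral_fintype_prod_volume_eq_prod (fun (x : X) (z : ℂ) => gaussianWeight z *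
    (z ^ Fintype.card {i // p i = x} * (starRingEnd ℂ) z ^ Fintype.card {i // q i = x}))]
  simp only [integral_gaussianWeight_mul]
  have h₁ : ∀ x, (if Fintype.card {i // p i = x} = Fintype.card {i // q i = x} then
      (2 * Real.pi * 2 ^ Fintype.card {i // p i = x} *
        (Fintype.card {i // p i = x}).factorial : ℂ) else 0) =
      (2 * Real.pi) * 2 ^ Fintype.card {i // p i = x} *
        ((if Fintype.card {i // p i = x} = Fintype.card {i // q i = x} then
        (Fintype.card {i // p i = x}).factorial else 0 : ℕ) : ℂ) := by
    intro x
    split_ifs <;> simp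
  simp only [h₁]
  rw [Finset.prod_mul_distrib, Finset.prod_mul_distrib, ← Nat.cast_prod, ← card_perm_matching,
    Finset.prod_const, Finset.card_univ, ← prod_apply_eq_prod_pow (fun _ => (2 : ℂ)),
    Finset.prod_const, Finset.card_univ]

end Wick

/-! ### The perturbative expansion of the partition function -/

section PartitionFunction

variable {N : ℕ}

theorem exp_neg_freeAction (φ : Index N → ℂ) :
    Complex.exp (-freeAction φ) = ∏ p, gaussianWeight (φ p) := by
  simp only [gaussianWeight]
  rw [← Complex.ofReal_prod, ← Real.exp_sum, Complex.ofReal_exp]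
  congr 1
  rw [freeAction, Complex.ofReal_sum, Fintype.sum_prod_type]
  simp only [Fintype.sum_prod_type]
  simp only [Finset.mul_sum, ← Finset.sum_neg_distrib]
  refine Finset.sum_congr rfl fun i _ => Finset.sum_congr rfl fun j _ =>
    Finset.sum_congr rfl fun k _ => ?_
  rw [hatField, Complex.conj_mul']
  push_cast
  ring

/-- The indices of the four fields at a vertex: those of the two `φ`, and those of the two `φ̂`. -/
abbrev VertexIndex (N : ℕ) : Type := (Bool → Index N) × (Bool → Index N)

/-- The six indices of the action parametrize injectively all index choices on which the vertex
tensor is non-zero. In this form a power of the interaction expands into independent vertices. -/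
theorem interaction_eq (φ : Index N → ℂ) :
    interaction φ = 1 / (4 * (scaling N : ℂ)) * ∑ P : VertexIndex N,
      vertexTensor (P.1 false) (P.2 false) (P.1 true) (P.2 true) *
        ((∏ i, φ (P.1 i)) * ∏ i, hatField φ (P.2 i)) := by
  rw [interaction]
  congr 1
  have h₁ : ∑ i, ∑ j, ∑ k, ∑ i', ∑ j', ∑ k',
      φ (i, j, k) * hatField φ (k, j', i') * φ (i', j, k') * hatField φ (k', j', i) =
      ∑ z : Fin N × Fin N × Fin N × Fin N × Fin N × Fin N,
        φ (z.1, z.2.1, z.2.2.1) * hatField φ (z.2.2.1, z.2.2.2.2.1, z.2.2.2.1) *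
          φ (z.2.2.2.1, z.2.1, z.2.2.2.2.2) * hatField φ (z.2.2.2.2.2, z.2.2.2.2.1, z.1) := by
    simp only [Fintype.sum_prod_type]
  rw [h₁]
  refine Fintype.sum_of_injective
    (fun z : Fin N × Fin N × Fin N × Fin N × Fin N × Fin N =>
      ((fun b => cond b (z.2.2.2.1, z.2.1, z.2.2.2.2.2) (z.1, z.2.1, z.2.2.1),
        fun b => cond b (z.2.2.2.2.2, z.2.2.2.2.1, z.1) (z.2.2.1, z.2.2.2.2.1, z.2.2.2.1)) :
        VertexIndex N)) ?_ _ _ ?_ ?_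
  · rintro ⟨i, j, k, i', j', k'⟩ ⟨a, b, c, a', b', c'⟩ h
    have h₁ := congrFun (congrArg Prod.fst h) false
    have h₂ := congrFun (congrArg Prod.snd h) false
    have h₃ := congrFun (congrArg Prod.fst h) true
    simp only [cond_false, cond_true, Prod.mk.injEq] at h₁ h₂ h₃ ⊢
    tauto
  · rintro ⟨p, q⟩ h
    rw [vertexTensor, if_neg, zero_mul]
    rintro ⟨h₁, h₂, h₃, h₄, h₅, h₆⟩
    dsimp only at h₁ h₂ h₃ h₄ h₅ h₆
    refine h ⟨((p false).1, (p false).2.1, (p false).2.2, (p true).1, (q false).2.1,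
      (p true).2.2), ?_⟩
    refine Prod.ext (funext ?_) (funext ?_)
    · rintro (_ | _) <;> simp [Prod.ext_iff, h₅]
    · rintro (_ | _) <;> simp [Prod.ext_iff, h₁, h₂, h₃, h₄, h₆]
  · rintro ⟨i, j, k, i', j', k'⟩
    simp [vertexTensor]
    ring

/-- The indices of the half-edges of `n` vertices. -/
def vertexIndexEquiv (n N : ℕ) : (Fin n → VertexIndex N) ≃
    (Fin n × Bool → Index N) × (Fin n × Bool → Index N) where
  toFun P := (fun h => (P h.1).1 h.2, fun h => (P h.1).2 h.2)
  invFun pq := fun x => (fun b => pq.1 (x, b), fun b => pq.2 (x, b))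
  left_inv _ := rfl
  right_inv _ := rfl

theorem interaction_pow (φ : Index N → ℂ) (n : ℕ) :
    (-interaction φ) ^ n = (-1 / (4 * (scaling N : ℂ))) ^ n *
      ∑ pq : (Fin n × Bool → Index N) × (Fin n × Bool → Index N),
        (∏ x, vertexTensor (pq.1 (x, false)) (pq.2 (x, false)) (pq.1 (x, true)) (pq.2 (x, true))) *
          ((∏ h, φ (pq.1 h)) * ∏ h, hatField φ (pq.2 h)) := by
  rw [interaction_eq, neg_mul_eq_neg_mul, ← neg_div, mul_pow, Fintype.sum_pow,
    ← (vertexIndexEquiv n N).sum_comp]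
  congr 1
  refine Finset.sum_congr rfl fun P _ => ?_
  simp only [Finset.prod_mul_distrib, Fintype.prod_prod_type, vertexIndexEquiv, Equiv.coe_fn_mk]

theorem propagator_eq (p q : Index N) :
    propagator p q = if p = (q.2.2, q.2.1, q.1) then 1 else 0 := by
  rw [propagator]
  congr 1
  simp [Prod.ext_iff]

/-- Wick's theorem for the fields `φ` and `φ̂`. -/
theorem integral_fields {ι : Type*} [Fintype ι] [DecidableEq ι] (p q : ι → Index N) :
    ∫ φ : Index N → ℂ, Complex.exp (-freeAction φ) * ((∏ h, φ (p h)) * ∏ h, hatField φ (q h)) =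
      (2 * Real.pi) ^ Fintype.card (Index N) * 2 ^ Fintype.card ι *
        ∑ σ : Equiv.Perm ι, ∏ h, propagator (p h) (q (σ h)) := by
  simp only [exp_neg_freeAction, hatField]
  rw [integral_gaussianWeight_monomial p fun h => ((q h).2.2, (q h).2.1, (q h).1)]
  congr 1
  simp only [propagator_eq, Finset.prod_ite_zero, Finset.prod_const_one, Finset.mem_univ,
    true_imp_iff]
  rw [Finset.sum_boole, Fintype.card_subtype]

theorem integrable_fields {ι : Type*} [Fintype ι] (p q : ι → Index N) :
    Integrable fun φ : Index N → ℂ =>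
      Complex.exp (-freeAction φ) * ((∏ h, φ (p h)) * ∏ h, hatField φ (q h)) := by
  simp only [exp_neg_freeAction, hatField]
  exact integrable_gaussianWeight_monomial p fun h => ((q h).2.2, (q h).2.1, (q h).1)

theorem integral_exp_neg_freeAction :
    ∫ φ : Index N → ℂ, Complex.exp (-freeAction φ) =
      ((2 * Real.pi) ^ Fintype.card (Index N) : ℂ) := by
  simpa using integral_fields (N := N) (ι := Empty) Empty.elim Empty.elim

namespace MOGraph

instance {V : Type u} [Finite V] : Finite (MOGraph V) :=
  Finite.of_injective MOGraph.edge fun _ _ h => MOGraph.ext h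

noncomputable instance {V : Type u} [Finite V] : Fintype (MOGraph V) := Fintype.ofFinite _

/-- A graph is determined by the permutation that encodes its edges. -/
def equivPerm (V : Type u) : MOGraph V ≃ Equiv.Perm (V × Bool) where
  toFun G := G.edge
  invFun e := ⟨e⟩
  left_inv _ := rfl
  right_inv _ := rfl

end MOGraph

open MOGraph

/-- The Feynman expansion. -/
theorem gaussianMean_interaction_pow (n : ℕ) :
    gaussianMean (N := N) (fun φ => (-interaction φ) ^ n) =
      (-1 / (scaling N : ℂ)) ^ n * ∑ G : MOGraph (Fin n), (N : ℂ) ^ G.totalFaceCount := by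
  classical
  have hpi : ((2 * Real.pi) ^ Fintype.card (Index N) : ℂ) ≠ 0 := by
    exact pow_ne_zero _ (by simp [Real.pi_ne_zero])
  rw [gaussianMean, integral_exp_neg_freeAction, div_eq_iff hpi]
  have h₁ : ∀ φ : Index N → ℂ, Complex.exp (-freeAction φ) * (-interaction φ) ^ n =
      (-1 / (4 * (scaling N : ℂ))) ^ n *
      ∑ pq : (Fin n × Bool → Index N) × (Fin n × Bool → Index N),
        (∏ x, vertexTensor (pq.1 (x, false)) (pq.2 (x, false)) (pq.1 (x, true)) (pq.2 (x, true))) *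
          (Complex.exp (-freeAction φ) * ((∏ h, φ (pq.1 h)) * ∏ h, hatField φ (pq.2 h))) := by
    intro φ
    rw [interaction_pow, mul_left_comm, Finset.mul_sum]
    congr 1
    exact Finset.sum_congr rfl fun pq _ => mul_left_comm _ _ _
  simp only [h₁]
  rw [integral_const_mul, integral_finsetSum _ fun pq _ => (integrable_fields _ _).const_mul _]
  simp only [integral_const_mul, integral_fields]
  have h₂ : ∀ G : MOGraph (Fin n), (N : ℂ) ^ G.totalFaceCount =
      ∑ pq : (Fin n × Bool → Index N) × (Fin n × Bool → Index N),
        (∏ x, vertexTensor (pq.1 (x, false)) (pq.2 (x, false)) (pq.1 (x, true)) (pq.2 (x, true))) *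
          ∏ h, propagator (pq.1 h) (pq.2 (G.edge h)) := by
    intro G
    rw [Fintype.sum_prod_type]
    refine (sum_vertexTensor_propagator G N).symm.trans ?_
    congr!
  simp only [h₂]
  rw [Finset.sum_comm, Finset.mul_sum, Finset.mul_sum, Finset.sum_mul]
  refine Finset.sum_congr rfl fun pq _ => ?_
  have h₄ : ∑ G : MOGraph (Fin n), ∏ h, propagator (pq.1 h) (pq.2 (G.edge h)) =
      ∑ σ : Equiv.Perm (Fin n × Bool), ∏ h, propagator (pq.1 h) (pq.2 (σ h)) :=
    (equivPerm (Fin n)).sum_comp fun σ => ∏ h, propagator (pq.1 h) (pq.2 (σ h))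
  rw [← Finset.mul_sum, h₄]
  -- The propagators 2 of the 2n edges cancel the factors 1/4 of the n vertices.
  have h₃ : (-1 / (4 * (scaling N : ℂ))) ^ n * 2 ^ Fintype.card (Fin n × Bool) =
      (-1 / (scaling N : ℂ)) ^ n := by
    rw [Fintype.card_prod, Fintype.card_bool, Fintype.card_fin, mul_comm n 2, pow_mul, ← mul_pow]
    congr 1
    rw [div_mul_eq_mul_div, mul_comm, show (2 : ℂ) ^ 2 = 4 by norm_num,
      mul_div_mul_left _ _ (by norm_num)]
  rw [← h₃]
  ring

end PartitionFunction

end MultiOrientable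

/-! ### Labelled graphs: orbit-stabilizer and splitting off a component. -/

namespace MultiOrientable

namespace MOGraph

/-! ### Relabelling -/

section Relabel

variable {V : Type u} {W : Type v}

/-- The action on half-edges of a bijection of the vertices and of rotations of the vertices. -/
def relabelEquiv (e : V ≃ W) (ε : V → Bool) : V × Bool ≃ W × Bool where
  toFun p := (e p.1, xor p.2 (ε p.1))
  invFun q := (e.symm q.1, xor q.2 (ε (e.symm q.1)))
  left_inv p := by simp
  right_inv q := by simp

/-- The graph obtained by renaming and rotating the vertices. -/
def relabel (G : MOGraph V) (e : V ≃ W) (ε : V → Bool) : MOGraph W where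
  edge := (relabelEquiv e ε).symm.trans (G.edge.trans (relabelEquiv e ε))

/-- The isomorphism with a relabelled graph. -/
def relabelIso (G : MOGraph V) (e : V ≃ W) (ε : V → Bool) : Iso G (G.relabel e ε) where
  vertex := e
  flip := ε
  edge_comm p := by
    change relabelEquiv e ε (G.edge ((relabelEquiv e ε).symm (relabelEquiv e ε p))) = _
    rw [Equiv.symm_apply_apply]
    rfl

theorem Iso.ext {G : MOGraph V} {H : MOGraph W} {f g : Iso G H} (h₁ : f.vertex = g.vertex)
    (h₂ : f.flip = g.flip) : f = g := by
  cases f; cases g; cases h₁; cases h₂; rfl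

/-- The target of an isomorphism is determined by its action. -/
theorem Iso.target_unique {G : MOGraph V} {H K : MOGraph W} (f : Iso G H) (g : Iso G K)
    (h₁ : f.vertex = g.vertex) (h₂ : f.flip = g.flip) : H = K := by
  have h : ∀ p, f.toEquiv p = g.toEquiv p := fun p => by
    rw [f.toEquiv_apply, g.toEquiv_apply, h₁, h₂]
  ext1; ext1 q
  obtain ⟨p, rfl⟩ := f.toEquiv.surjective q
  rw [f.edge_toEquiv, h, h, g.edge_toEquiv]

/-- Renaming the vertices, as a bijection. -/
def relabelMOGraph (e : V ≃ W) : MOGraph V ≃ MOGraph W where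
  toFun G := G.relabel e fun _ => false
  invFun G := G.relabel e.symm fun _ => false
  left_inv G := by
    ext1; ext1 p
    simp [relabel, relabelEquiv]
  right_inv G := by
    ext1; ext1 p
    simp [relabel, relabelEquiv]

end Relabel

/-! ### Counting graphs isomorphic to a given one -/

section OrbitStabilizer

variable {V : Type u}

instance {W : Type v} [Finite V] [Finite W] (G : MOGraph V) (H : MOGraph W) : Finite (Iso G H) :=
  Finite.of_injective (fun f => (f.vertex, f.flip)) fun _ _ h =>
    Iso.ext (congrArg Prod.fst h) (congrArg Prod.snd h)

/-- Isomorphisms from a graph to all graphs on the same vertices are the same as relabellings. -/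
noncomputable def sigmaIsoEquiv (G : MOGraph V) :
    (Σ H : MOGraph V, Iso G H) ≃ Equiv.Perm V × (V → Bool) :=
  Equiv.ofBijective (fun z => (z.2.vertex, z.2.flip)) ⟨by
    rintro ⟨H, f⟩ ⟨K, g⟩ h
    have h₁ : f.vertex = g.vertex := congrArg Prod.fst h
    have h₂ : f.flip = g.flip := congrArg Prod.snd h
    obtain rfl := f.target_unique g h₁ h₂
    rw [Iso.ext h₁ h₂], fun z => ⟨⟨_, G.relabelIso z.1 z.2⟩, rfl⟩⟩

/-- Composition with a fixed isomorphism. -/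
def isoEquivAut {G H : MOGraph V} (f : Iso G H) : Iso G H ≃ Iso G G where
  toFun g := g.trans f.symm
  invFun g := g.trans f
  left_inv g := Iso.ext (by ext; simp [Iso.trans, Iso.symm]) (by
    ext; simp [Iso.trans, Iso.symm])
  right_inv g := Iso.ext (by ext; simp [Iso.trans, Iso.symm]) (by
    ext; simp [Iso.trans, Iso.symm])

/-- Pairs of a graph H and an isomorphism from G to H are counted twice: they are the n! 2^n
relabellings of G, and over each isomorphic H there are as many as automorphisms of G. -/
theorem card_isomorphic_mul_card_aut [Fintype V] (G : MOGraph V) :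
    Nat.card {H : MOGraph V // Nonempty (Iso G H)} * Nat.card (Iso G G) =
      (Fintype.card V).factorial * 2 ^ Fintype.card V := by
  classical
  have h₁ : Nat.card (Σ H : MOGraph V, Iso G H) =
      (Fintype.card V).factorial * 2 ^ Fintype.card V := by
    rw [Nat.card_congr (sigmaIsoEquiv G), Nat.card_prod, Nat.card_perm, Nat.card_fun,
      Nat.card_eq_fintype_card, Nat.card_eq_fintype_card, Fintype.card_bool]
  rw [← h₁, Nat.card_sigma]
  have h₂ : ∀ H : MOGraph V, Nat.card (Iso G H) =
      if Nonempty (Iso G H) then Nat.card (Iso G G) else 0 := by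
    intro H
    split_ifs with h
    · obtain ⟨f⟩ := h
      exact Nat.card_congr (isoEquivAut f)
    · have := not_nonempty_iff.mp h
      exact Nat.card_of_isEmpty
  rw [Finset.sum_congr rfl fun H _ => h₂ H, ← Finset.sum_filter, Finset.sum_const, smul_eq_mul,
    Nat.card_eq_fintype_card, Fintype.card_subtype]

end OrbitStabilizer

/-! ### Gluing -/

section Glue

variable {V : Type u}

open Classical in
/-- The graph obtained from two graphs on complementary sets of vertices. -/
noncomputable def glue {S : Set V} (G : MOGraph S) (H : MOGraph (Sᶜ : Set V)) : MOGraph V :=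
  (G.disjointUnion H).relabel (Equiv.Set.sumCompl S) fun _ => false

theorem glue_edge_of_mem {S : Set V} (G : MOGraph S) (H : MOGraph (Sᶜ : Set V)) {x : V}
    (hx : x ∈ S) (i : Bool) :
    (G.glue H).edge (x, i) = ((G.edge (⟨x, hx⟩, i)).1.1, (G.edge (⟨x, hx⟩, i)).2) := by
  classical
  simp [glue, relabel, relabelEquiv, Equiv.Set.sumCompl_symm_apply_of_mem hx, inlHalf]

theorem glue_edge_of_notMem {S : Set V} (G : MOGraph S) (H : MOGraph (Sᶜ : Set V)) {x : V}
    (hx : x ∉ S) (i : Bool) :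
    (G.glue H).edge (x, i) = ((H.edge (⟨x, hx⟩, i)).1.1, (H.edge (⟨x, hx⟩, i)).2) := by
  classical
  simp [glue, relabel, relabelEquiv, Equiv.Set.sumCompl_symm_apply_of_notMem hx, inrHalf]

theorem glue_isInvariant {S : Set V} (G : MOGraph S) (H : MOGraph (Sᶜ : Set V)) :
    (G.glue H).IsInvariant S := by
  rintro ⟨x, i⟩
  by_cases hx : x ∈ S
  · rw [glue_edge_of_mem G H hx]
    exact iff_of_true hx (G.edge (⟨x, hx⟩, i)).1.2
  · rw [glue_edge_of_notMem G H hx]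
    exact iff_of_false hx (H.edge (⟨x, hx⟩, i)).1.2

theorem restrict_glue {S : Set V} (G : MOGraph S) (H : MOGraph (Sᶜ : Set V)) :
    (G.glue H).restrict (glue_isInvariant G H) = G := by
  ext1; ext1 ⟨⟨x, hx⟩, i⟩
  simp [restrict, glue_edge_of_mem G H hx]

theorem restrict_compl_glue {S : Set V} (G : MOGraph S) (H : MOGraph (Sᶜ : Set V)) :
    (G.glue H).restrict (glue_isInvariant G H).compl = H := by
  ext1; ext1 ⟨⟨x, hx⟩, i⟩
  simp [restrict, glue_edge_of_notMem G H hx]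

theorem eq_of_restrict_eq {S : Set V} {G H : MOGraph V} (hG : G.IsInvariant S)
    (hH : H.IsInvariant S) (h₁ : G.restrict hG = H.restrict hH)
    (h₂ : G.restrict hG.compl = H.restrict hH.compl) : G = H := by
  ext1; ext1 ⟨x, i⟩
  by_cases hx : x ∈ S
  · have := congrArg (fun K : MOGraph S => K.edge (⟨x, hx⟩, i)) h₁
    simpa [restrict, Prod.ext_iff] using this
  · have := congrArg (fun K : MOGraph (Sᶜ : Set V) => K.edge (⟨x, hx⟩, i)) h₂
    simpa [restrict, Prod.ext_iff] using this

end Glue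

/-! ### Sums over labelled graphs -/

section Cluster

variable {R : Type w} [CommSemiring R] (c : R)

/-- The sum of `c ^ F` over all labelled graphs, `F` being the number of faces. -/
noncomputable def labelledSum (V : Type u) [Finite V] : R :=
  ∑ G : MOGraph V, c ^ G.totalFaceCount

open Classical in
/-- The sum of `c ^ F` over all connected labelled graphs, `F` being the number of faces. -/
noncomputable def connectedSum (V : Type u) [Finite V] : R :=
  ∑ G : MOGraph V, if G.Connected then c ^ G.totalFaceCount else 0

variable {V : Type u} {W : Type v} [Finite V] [Finite W]

theorem labelledSum_congr (e : V ≃ W) : labelledSum c V = labelledSum c W :=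
  Fintype.sum_equiv (relabelMOGraph e) _ _ fun G => by
    rw [(G.relabelIso e fun _ => false).totalFaceCount_eq]; rfl

theorem connectedSum_congr (e : V ≃ W) : connectedSum c V = connectedSum c W := by
  refine Fintype.sum_equiv (relabelMOGraph e) _ _ fun G => ?_
  have f : Iso G (relabelMOGraph e G) := G.relabelIso e fun _ => false
  rw [f.totalFaceCount_eq]
  classical exact if_congr f.connected_iff rfl rfl

theorem labelledSum_eq_fin {n : ℕ} (hn : Nat.card V = n) :
    labelledSum c V = labelledSum c (Fin n) :=
  labelledSum_congr c (Finite.equivFinOfCardEq hn)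

theorem connectedSum_eq_fin {n : ℕ} (hn : Nat.card V = n) :
    connectedSum c V = connectedSum c (Fin n) :=
  connectedSum_congr c (Finite.equivFinOfCardEq hn)

open Classical in
/-- The sum over the graphs in which a given vertex has a given connected component. -/
theorem sum_component_eq {S : Set V} {x : V} (hx : x ∈ S) :
    ∑ G : MOGraph V with G.component x = S, c ^ G.totalFaceCount =
      connectedSum c S * labelledSum c (Sᶜ : Set V) := by
  rw [connectedSum, ← Finset.sum_filter, labelledSum, Finset.sum_mul_sum, ← Finset.sum_product']
  have hinv : ∀ G : MOGraph V, G ∈ Finset.univ.filter (fun G : MOGraph V => G.component x = S) →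
      G.IsInvariant S := fun G hG => by
    rw [← (Finset.mem_filter.mp hG).2]
    exact isInvariant_component x
  refine Finset.sum_bij
    (fun G hG => (G.restrict (hinv G hG), G.restrict (hinv G hG).compl)) ?_ ?_ ?_ ?_
  · intro G hG
    simp only [Finset.mem_product, Finset.mem_filter, Finset.mem_univ, true_and, and_true]
    exact (connected_restrict_iff _ hx).mpr (Finset.mem_filter.mp hG).2
  · intro G hG H hH h
    exact eq_of_restrict_eq (hinv G hG) (hinv H hH) (congrArg Prod.fst h) (congrArg Prod.snd h)
  · rintro ⟨G, H⟩ hGH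
    simp only [Finset.mem_product, Finset.mem_filter, Finset.mem_univ, true_and, and_true] at hGH
    refine ⟨G.glue H, ?_, ?_⟩
    · simp only [Finset.mem_filter, Finset.mem_univ, true_and]
      rw [← connected_restrict_iff (glue_isInvariant G H) hx, restrict_glue]
      exact hGH
    · exact Prod.ext (restrict_glue G H) (restrict_compl_glue G H)
  · intro G hG
    rw [← (disjointUnionRestrictIso (hinv G hG)).totalFaceCount_eq, totalFaceCount_disjointUnion,
      pow_add]

/-- The recursion that expresses the sum over all graphs by the sum over connected graphs. -/
theorem labelledSum_succ (n : ℕ) :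
    labelledSum c (Fin (n + 1)) = ∑ m ∈ Finset.range (n + 1),
      n.choose m • (connectedSum c (Fin (n + 1 - m)) * labelledSum c (Fin m)) := by
  classical
  have hcard : (Finset.univ.erase (0 : Fin (n + 1))).card = n := by simp
  have key := Finset.sum_powerset_apply_card
    (fun m => connectedSum c (Fin (n + 1 - m)) * labelledSum c (Fin m))
    (x := Finset.univ.erase (0 : Fin (n + 1)))
  rw [hcard] at key
  -- The fibres are indexed by the complement of the component of vertex 0, an arbitrary subset of
  -- the n other vertices; hence the binomial coefficient.
  rw [← key, labelledSum, ← Finset.sum_fiberwise_of_maps_to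
    (g := fun G : MOGraph (Fin (n + 1)) => Finset.univ.filter fun y => y ∉ G.component 0)
    (t := (Finset.univ.erase (0 : Fin (n + 1))).powerset)]
  · refine Finset.sum_congr rfl fun T hT => ?_
    have h0 : (0 : Fin (n + 1)) ∈ ((T : Set (Fin (n + 1)))ᶜ : Set (Fin (n + 1))) := fun h =>
      (Finset.mem_erase.mp (Finset.mem_powerset.mp hT h)).1 rfl
    have h₁ := sum_component_eq c h0
    have c₁ : Nat.card ((T : Set (Fin (n + 1)))ᶜᶜ : Set (Fin (n + 1))) = T.card := by
      rw [compl_compl]; simp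
    have c₂ : Nat.card ((T : Set (Fin (n + 1)))ᶜ : Set (Fin (n + 1))) = n + 1 - T.card := by
      rw [← Finset.coe_compl, Nat.card_coe_set_eq, Set.ncard_coe_finset, Finset.card_compl,
        Fintype.card_fin]
    rw [labelledSum_eq_fin c c₁, connectedSum_eq_fin c c₂] at h₁
    rw [← h₁]
    refine Finset.sum_congr (Finset.filter_congr fun G _ => ?_) fun _ _ => rfl
    rw [Finset.ext_iff, Set.ext_iff]
    refine forall_congr' fun y => ?_
    simp only [Finset.mem_filter, Finset.mem_univ, true_and, Set.mem_compl_iff, Finset.mem_coe]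
    tauto
  · intro G _
    simp only [Finset.mem_powerset]
    intro y hy
    simp only [Finset.mem_filter, Finset.mem_univ, true_and] at hy
    simp only [Finset.mem_erase, Finset.mem_univ, and_true]
    rintro rfl
    exact hy (mem_component_self _)

theorem labelledSum_fin_zero : labelledSum c (Fin 0) = 1 := by
  have : Unique (MOGraph (Fin 0)) :=
    { default := ⟨Equiv.refl _⟩
      uniq := fun G => by ext1; ext1 p; exact p.1.elim0 }
  have h : ∀ G : MOGraph (Fin 0), G.totalFaceCount = 0 := fun G =>
    Finset.sum_eq_zero fun t _ => by
      have : IsEmpty (G.Face t) := ⟨fun o => by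
        induction o using Orbits.ind with | h x => exact x.elim (·.1.elim0) (·.1.elim0)⟩
      exact Nat.card_of_isEmpty
  rw [labelledSum, Fintype.sum_unique, h, pow_zero]

theorem connectedSum_fin_zero : connectedSum c (Fin 0) = 0 := by
  classical
  refine Finset.sum_eq_zero fun G _ => if_neg fun h => ?_
  obtain ⟨⟨x⟩, -⟩ := connected_iff.mp h
  exact x.elim0

end Cluster

end MOGraph

end MultiOrientable

/-! ### The logarithm of the partition function and the expansion in powers of N. -/

namespace MultiOrientable

open MOGraph

/-! ### Logarithms of formal power series -/

theorem derivative_log_mul_one_add_X :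
    PowerSeries.derivative ℂ (PowerSeries.log ℂ) * (1 + PowerSeries.X) = 1 := by
  rw [PowerSeries.deriv_log]
  ext n
  rw [mul_add, mul_one, map_add]
  cases n with
  | zero => simp
  | succ n =>
    rw [PowerSeries.coeff_succ_mul_X, PowerSeries.coeff_mk, PowerSeries.coeff_mk,
      PowerSeries.coeff_one]
    simp [pow_succ]

/-- A power series `L` with `L(0) = 0` and `Z' = Z L'`, where `Z(0) = 1`, is the logarithm of `Z`. -/
theorem log_subst_eq {Z L : PowerSeries ℂ} (hZ : PowerSeries.constantCoeff Z = 1)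
    (hL : PowerSeries.constantCoeff L = 0)
    (h : PowerSeries.derivative ℂ Z = Z * PowerSeries.derivative ℂ L) :
    (PowerSeries.log ℂ).subst (Z - 1) = L := by
  have hZ' : PowerSeries.constantCoeff (Z - 1) = 0 := by simp [hZ]
  have hs : PowerSeries.HasSubst (Z - 1) := PowerSeries.HasSubst.of_constantCoeff_zero' hZ'
  refine PowerSeries.derivative.ext ?_ ?_
  -- Substituting Z - 1 into log'(X)(1 + X) = 1 shows that the factor from the chain rule is inverse
  -- to Z.
  · rw [PowerSeries.derivative_subst hs, map_sub, h]
    have h₁ := congrArg (PowerSeries.subst (Z - 1)) derivative_log_mul_one_add_X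
    have h₂ : PowerSeries.subst (Z - 1) (1 : PowerSeries ℂ) = 1 := by
      rw [← PowerSeries.coe_substAlgHom hs, map_one]
    rw [PowerSeries.subst_mul hs, PowerSeries.subst_add hs, PowerSeries.subst_X hs, h₂,
      add_sub_cancel] at h₁
    have h₃ : PowerSeries.derivative ℂ (1 : PowerSeries ℂ) = 0 := by simp
    rw [h₃, sub_zero, ← mul_assoc, h₁, one_mul]
  · rw [hL]
    exact PowerSeries.constantCoeff_logOf hZ

theorem partitionFunction_eq (N : ℕ) :
    partitionFunction N = PowerSeries.mk fun n =>
      labelledSum (N : ℂ) (Fin n) / (n.factorial : ℂ) * (-1 / (scaling N : ℂ)) ^ n := by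
  ext n
  rw [partitionFunction, PowerSeries.coeff_mk, PowerSeries.coeff_mk, gaussianMean_interaction_pow,
    labelledSum]
  ring

/-- The linked cluster theorem: the logarithm of the partition function is the sum over connected
labelled graphs. -/
theorem coeff_freeEnergy (N n : ℕ) :
    PowerSeries.coeff n (freeEnergy N) =
      -(connectedSum (N : ℂ) (Fin n) / (n.factorial : ℂ) * (-1 / (scaling N : ℂ)) ^ n) := by
  set L : PowerSeries ℂ := PowerSeries.mk fun n =>
      connectedSum (N : ℂ) (Fin n) / (n.factorial : ℂ) * (-1 / (scaling N : ℂ)) ^ n with hL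
  have h : (PowerSeries.log ℂ).subst (partitionFunction N - 1) = L := by
    refine log_subst_eq ?_ ?_ ?_
    · rw [partitionFunction_eq, ← PowerSeries.coeff_zero_eq_constantCoeff_apply,
        PowerSeries.coeff_mk, labelledSum_fin_zero]
      simp
    · rw [hL, ← PowerSeries.coeff_zero_eq_constantCoeff_apply,
        PowerSeries.coeff_mk, connectedSum_fin_zero]
      simp
    -- The coefficient of degree n in Z' = Z L' is the recursion `labelledSum_succ` divided by n!.
    · ext n
      rw [partitionFunction_eq, PowerSeries.coeff_derivative, PowerSeries.coeff_mk,
        PowerSeries.coeff_mul, labelledSum_succ]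
      simp only [PowerSeries.coeff_derivative, hL, PowerSeries.coeff_mk]
      rw [Finset.Nat.sum_antidiagonal_eq_sum_range_succ (fun i j =>
        labelledSum (N : ℂ) (Fin i) / (i.factorial : ℂ) * (-1 / (scaling N : ℂ)) ^ i *
        (connectedSum (N : ℂ) (Fin (j + 1)) / ((j + 1).factorial : ℂ) *
          (-1 / (scaling N : ℂ)) ^ (j + 1) * ((j : ℂ) + 1))), Finset.sum_div, Finset.sum_mul,
        Finset.sum_mul]
      refine Finset.sum_congr rfl fun m hm => ?_
      obtain ⟨k, rfl⟩ : ∃ k, n = m + k :=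
        Nat.exists_eq_add_of_le (Nat.lt_succ_iff.mp (Finset.mem_range.mp hm))
      have e₁ : m + k + 1 - m = k + 1 := by omega
      have e₂ : m + k - m = k := by omega
      rw [e₁, e₂, nsmul_eq_mul, Nat.cast_add_choose]
      have f₁ : ((m.factorial : ℕ) : ℂ) ≠ 0 := by exact_mod_cast m.factorial_ne_zero
      have f₂ : ((k.factorial : ℕ) : ℂ) ≠ 0 := by exact_mod_cast k.factorial_ne_zero
      have f₃ : (((m + k).factorial : ℕ) : ℂ) ≠ 0 := by exact_mod_cast (m + k).factorial_ne_zero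
      have f₄ : ((k : ℂ) + 1) ≠ 0 := by exact_mod_cast k.succ_ne_zero
      have f₅ : ((m : ℂ) + (k + 1)) ≠ 0 := by exact_mod_cast (m + k).succ_ne_zero
      rw [Nat.factorial_succ, Nat.factorial_succ, add_assoc m k 1, pow_add]
      push_cast
      field_simp
      ring
  rw [freeEnergy, h, map_neg, hL, PowerSeries.coeff_mk]

/-! ### Sums over isomorphism classes -/

open Classical in
/-- The sum over isomorphism classes, weighted by symmetry factors, in terms of labelled graphs. -/
theorem graphSum_eq (n : ℕ) (P : MOGraph (Fin n) → Prop) (A : MOGraph (Fin n) → ℂ)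
    (hP : ∀ G H, Nonempty (Iso G H) → (P G ↔ P H)) (hA : ∀ G H, Nonempty (Iso G H) → A G = A H) :
    graphSum n P A =
      (∑ G : MOGraph (Fin n), if G.Connected ∧ P G then A G else 0) / (n.factorial : ℂ) := by
  rw [← Finset.sum_fiberwise Finset.univ (fun G => (Quotient.mk _ G : FeynmanGraph n)), graphSum,
    Finset.sum_div]
  refine Finset.sum_congr (by ext; simp) fun q _ => ?_
  have hq : ∀ G, (Quotient.mk _ G : FeynmanGraph n) = q ↔ Nonempty (Iso q.out G) := by
    intro G
    constructor
    · intro h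
      have : q.out ≈ G := Quotient.exact ((Quotient.out_eq q).trans h.symm)
      exact this
    · intro h
      rw [← Quotient.out_eq q]
      exact (Quotient.sound (s := isoSetoid n) h).symm
  have h₁ : ∀ G ∈ Finset.univ.filter (fun G => (Quotient.mk _ G : FeynmanGraph n) = q),
      (if G.Connected ∧ P G then A G else 0) =
        if q.out.Connected ∧ P q.out then A q.out else 0 := by
    intro G hG
    have hG' := (hq G).mp (Finset.mem_filter.mp hG).2
    rw [hA _ _ hG']
    refine if_congr ?_ rfl rfl
    rw [hP _ _ hG']
    obtain ⟨f⟩ := hG'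
    rw [f.connected_iff]
  rw [Finset.sum_congr rfl h₁, Finset.sum_const, nsmul_eq_mul]
  -- The class has n! 2^n / |Aut| = n! / s labelled members, so dividing by n! leaves the weight
  -- 1/s.
  have h₂ := card_isomorphic_mul_card_aut q.out
  rw [Nat.card_eq_fintype_card, Fintype.card_subtype, Fintype.card_fin,
    ← Finset.filter_congr fun G _ => hq G] at h₂
  have h₃ : ((Nat.card (Iso q.out q.out) : ℕ) : ℂ) ≠ 0 := by
    have : Nonempty (Iso q.out q.out) := ⟨Iso.refl _⟩
    exact_mod_cast Nat.card_pos.ne'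
  have h₄ : ((n.factorial : ℕ) : ℂ) ≠ 0 := by exact_mod_cast n.factorial_ne_zero
  have h₅ := congrArg (Nat.cast : ℕ → ℂ) h₂
  push_cast at h₅
  split_ifs
  · rw [symmetryFactor, Fintype.card_fin]
    push_cast
    field_simp
    linear_combination -(A q.out) * h₅
  · simp

theorem amplitude_eq_of_iso {V : Type u} [Fintype V] {G H : MOGraph V} (f : Iso G H) (lam : ℂ)
    (N : ℕ) : amplitude G lam N = amplitude H lam N := by
  rw [amplitude_eq, amplitude_eq, f.totalFaceCount_eq]

/-- The free energy is the sum of the amplitudes of the connected graphs. -/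
theorem coeff_freeEnergy_eq_graphSum (N n : ℕ) (lam : ℂ) :
    PowerSeries.coeff n (freeEnergy N) * lam ^ n =
      (-1) ^ (n + 1) * graphSum n (fun _ => True) fun G => amplitude G lam N := by
  classical
  have h : graphSum n (fun _ => True) (fun G => amplitude G lam N) =
      (lam / (scaling N : ℂ)) ^ n * connectedSum (N : ℂ) (Fin n) / (n.factorial : ℂ) := by
    rw [graphSum_eq n _ _ (fun _ _ _ => Iff.rfl) (fun _ _ ⟨f⟩ => amplitude_eq_of_iso f lam N),
      connectedSum, Finset.mul_sum]
    congr 1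
    refine Finset.sum_congr rfl fun G _ => ?_
    rw [amplitude_eq, Nat.card_eq_fintype_card, Fintype.card_fin, mul_ite, mul_zero]
    simp only [and_true]
  rw [h, coeff_freeEnergy, div_pow, div_pow, pow_succ]
  ring

theorem exists_of_graphSum_ne_zero {n : ℕ} {P : MOGraph (Fin n) → Prop}
    {A : MOGraph (Fin n) → ℂ} (h : graphSum n P A ≠ 0) : ∃ G, G.Connected ∧ P G := by
  obtain ⟨q, -, hq⟩ := Finset.exists_ne_zero_of_sum_ne_zero h
  by_contra! hcon
  exact hq (if_neg fun h => hcon _ h.1 h.2)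

/-- Twice the degree of a connected graph is bounded in terms of the number of vertices. -/
theorem lt_of_coeff_freeEnergyCoeff_ne_zero {n m : ℕ}
    (h : PowerSeries.coeff n (freeEnergyCoeff m) ≠ 0) : m < 3 * n + 7 := by
  rw [freeEnergyCoeff, PowerSeries.coeff_mk] at h
  obtain ⟨G, hG, hdeg⟩ := exists_of_graphSum_ne_zero (right_ne_zero_of_mul h)
  -- Here m = 3n + 6 - 2F, hence m ≤ 3n + 6.
  rw [hG.degree_eq_div, div_left_inj' two_ne_zero, Nat.cast_inj, Nat.card_eq_fintype_card,
    Fintype.card_fin] at hdeg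
  omega

/-- The expansion of the free energy in powers of `N`. -/
theorem coeff_freeEnergy_eq_finsum {N : ℕ} (hN : 1 ≤ N) (n : ℕ) :
    PowerSeries.coeff n (freeEnergy N) =
      ∑ᶠ m : ℕ, PowerSeries.coeff n (freeEnergyCoeff m) *
        (((N : ℝ) ^ (3 - (m : ℝ) / 2) : ℝ) : ℂ) := by
  have h := coeff_freeEnergy_eq_graphSum N n 1
  rw [one_pow, mul_one] at h
  rw [h, finsum_eq_sum_of_support_subset (s := Finset.range (3 * n + 7))]
  swap
  · intro m hm
    rw [Finset.coe_range]
    exact lt_of_coeff_freeEnergyCoeff_ne_zero (left_ne_zero_of_mul hm)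
  simp only [freeEnergyCoeff, PowerSeries.coeff_mk, graphSum, mul_assoc, ← Finset.mul_sum,
    Finset.sum_mul]
  rw [Finset.sum_comm]
  congr 1
  refine Finset.sum_congr rfl fun q _ => ?_
  by_cases hq : q.out.Connected
  · have hd := hq.degree_eq_div
    rw [Nat.card_eq_fintype_card, Fintype.card_fin] at hd
    -- Twice the degree: the only m for which this graph contributes.
    set d := 3 * n + 6 - 2 * q.out.totalFaceCount
    rw [if_pos ⟨hq, trivial⟩, Finset.sum_eq_single d]
    · rw [if_pos ⟨hq, hd⟩, amplitude_eq_degree _ _ hN, hd]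
      push_cast
      rw [one_pow]
      ring
    · intro m _ hm
      rw [if_neg, zero_mul]
      rintro ⟨-, h'⟩
      rw [hd, div_left_inj' two_ne_zero, Nat.cast_inj] at h'
      exact hm h'.symm
    · intro hmem
      exact absurd (Finset.mem_range.mpr (by omega)) hmem
  · rw [if_neg fun h => hq h.1]
    refine (Finset.sum_eq_zero fun m _ => ?_).symm
    rw [if_neg fun h => hq h.1, zero_mul]

end MultiOrientable

theorem mainTheorem1 :
    (∀ (V : Type u) [Fintype V] (G : MultiOrientable.MOGraph V), G.Connected →
      (∀ t : MultiOrientable.StrandType,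
        (G.jacket t).Connected ∧ 0 ≤ (G.jacket t).nonorientableGenus) ∧
      (∃ m : ℕ, G.degree = (m : ℚ) / 2) ∧
      ∀ (lam : ℂ) (N : ℕ), 1 ≤ N →
        MultiOrientable.amplitude G lam N =
          lam ^ Fintype.card V * (((N : ℝ) ^ (3 - (G.degree : ℝ)) : ℝ) : ℂ)) ∧
    (∀ n : ℕ, {m : ℕ | PowerSeries.coeff n (MultiOrientable.freeEnergyCoeff m) ≠ 0}.Finite) ∧
    (∀ N : ℕ, 1 ≤ N → ∀ n : ℕ,
      (∀ lam : ℂ, PowerSeries.coeff n (MultiOrientable.freeEnergy N) * lam ^ n =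
        (-1) ^ (n + 1) * MultiOrientable.graphSum n (fun _ => True)
          (fun G => MultiOrientable.amplitude G lam N)) ∧
      PowerSeries.coeff n (MultiOrientable.freeEnergy N) =
        ∑ᶠ m : ℕ, PowerSeries.coeff n (MultiOrientable.freeEnergyCoeff m) *
          (((N : ℝ) ^ (3 - (m : ℝ) / 2) : ℝ) : ℂ)) ∧
    (∀ (V : Type u) [Fintype V] (G : MultiOrientable.MOGraph V),
      (G.Connected ∧ G.degree = 0) ↔ G.IsMelonic) := by
  refine ⟨fun V _ G hG => ⟨fun t => ⟨hG.jacket t, hG.nonorientableGenus_nonneg t⟩,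
    ⟨_, hG.degree_eq_div⟩, fun lam N hN => G.amplitude_eq_degree lam hN⟩, fun n => ?_,
    fun N hN n => ⟨MultiOrientable.coeff_freeEnergy_eq_graphSum N n,
      MultiOrientable.coeff_freeEnergy_eq_finsum hN n⟩,
    fun V _ G => MultiOrientable.MOGraph.connected_and_degree_eq_zero_iff⟩
  exact (Set.finite_lt_nat (3 * n + 7)).subset fun m hm =>
    MultiOrientable.lt_of_coeff_freeEnergyCoeff_ne_zero hm
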